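/- **Setting.** A model $\mathcal M=\{A,B,C,D\}$ with $A\in\mathbb C^{n\times n}$, $B\in\mathbb C^{n\times m}$, $C\in\mathbb C^{m\times n}$, $D\in\mathbb C^{m\times m}$, $m\ge 1$, is a realization of $\mathcal T(s)=C(sI-A)^{-1}B+D$. It is minimal if $(A,B)$ and $(A^{\mathsf H},C^{\mathsf H})$ are controllable. It is strictly passive if all eigenvalues of $A$ lie in the open left half plane, $\mathcal T(\imath\omega)^{\mathsf H}+\mathcal T(\imath\omega)>0$ for all real $\omega$, and $D^{\mathsf H}+D>0$; a transfer function is called strictly passive if its minimal realizations are. For Hermitian $X$ put $$W(X,\mathcal M)=\begin{bmatrix}-A^{\mathsf H}X-XA & C^{\mathsf H}-XB\\ C-B^{\mathsf H}X & D^{\mathsf H}+D\end{bmatrix}.$$ Let $\|\Delta\|$ be the spectral norm or the Frobenius norm of $\begin{bmatrix}\Delta_A&\Delta_B\\ \Delta_C&\Delta_D\end{bmatrix}$. For $X>0$ with $W(X,\mathcal M)>0$ let $$\rho_{\mathcal M}(X)=\inf\{\|\Delta\| : \det W(X,\mathcal M+\Delta)=0\},\qquad \rho_{\mathcal M}=\sup\{\rho_{\mathcal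 M}(X) : X>0,\ W(X,\mathcal M)>0\}$$ be the $X$-passivity radius and the passivity radius of $\mathcal M$ ($\rho_{\mathcal M}=0$ if there is no such $X$), and let $\delta_{\mathcal M}=\inf\{\|\Delta\| : \mathcal M+\Delta \text{ is not strictly passive}\}$. For real $\xi$ let $\mathcal M_\xi=\{A+\frac{\xi}{2}I,B,C,D-\frac{\xi}{2}I\}$, a realization of $\mathcal T_\xi(s)=C((s-\frac{\xi}{2})I-A)^{-1}B+D-\frac{\xi}{2}I$. A model is port-Hamiltonian with $Q=I$ if $A=J-R$, $B=G-K$, $C=(G+K)^{\mathsf H}$, $D=S+N$, where $\begin{bmatrix}J&G\\-G^{\mathsf H}&N\end{bmatrix}$ is skew-Hermitian and $\begin{bmatrix}R&K\\K^{\mathsf H}&S\end{bmatrix}$ is Hermitian positive semidefinite. For invertible $T$ let $\mathcal M_T=\{TAT^{-1},TB,CT^{-1},D\}$. **Theorem.** Let $\mathcal M$ be a minimal realization of a strictly passive transfer function $\mathcal T$, and let $\Xi=\sup\{\xi\in\mathbb R : \mathcal T_\xi \text{ is strictly passive}\}$. Then, for the spectral norm as well as for the Frobenius norm: 1. $0<\Xi<\infty$.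 2. $\Xi/2$ is the maximum of the passivity radii $\rho_{\mathcal M'}$ over all realizations $\mathcal M'$ of $\mathcal T$, of any state dimension; it is also the maximum of $\delta_{\mathcal M'}$ over all these realizations. 3. There is $X>0$ with $W(X,\mathcal M_\Xi)\ge 0$. If $X=T^{\mathsf H}T$ with $T$ invertible and $W(X,\mathcal M_\Xi)\ge 0$, then $W(X,\mathcal M)>0$, and $\mathcal M_T$ is a port-Hamiltonian realization of $\mathcal T$ with $Q=I$ that attains both maxima: $\rho_{\mathcal M_T}(I)=\rho_{\mathcal M_T}=\delta_{\mathcal M_T}=\Xi/2$. 4. Conversely, if $X=T^{\mathsf H}T$ with $T$ invertible, $W(X,\mathcal M)>0$ and $\rho_{\mathcal M_T}(I)=\Xi/2$, then $W(X,\mathcal M_\Xi)\ge 0$. Moreover, a minimal realization $\mathcal M'$ of $\mathcal T$ has $\rho_{\mathcal M'}=\Xi/2$ if and only if there are an invertible $V$ and $X>0$ with $\mathcal M'=\{VAV^{-1},VB,CV^{-1},D\}$, $W(X,\mathcal M_\Xi)\ge 0$ and $\rho_{\mathcal M'}(V^{-\mathsf H}XV^{-1})=\Xi/2$. -/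

import Mathlib

open scoped Matrix ENNReal ComplexOrder

/-- A state-space model `{A, B, C, D}` with `n` states and `m` inputs and outputs:
`x' = A x + B u`, `y = C x + D u`. -/
@[ext]
structure StateSpace (n m : ℕ) where
  A : Matrix (Fin n) (Fin n) ℂ
  B : Matrix (Fin n) (Fin m) ℂ
  C : Matrix (Fin m) (Fin n) ℂ
  D : Matrix (Fin m) (Fin m) ℂ

/-- The two norms used to measure a perturbation of a model. -/
inductive NormKind where
  | spectral
  | frobenius

noncomputable section

namespace StateSpace

variable {n m k : ℕ}

/-- Entrywise sum; `M + Δ` is the model `M` perturbed by `Δ`. -/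
instance instAdd : Add (StateSpace n m) :=
  ⟨fun M N => ⟨M.A + N.A, M.B + N.B, M.C + N.C, M.D + N.D⟩⟩

/-- The transfer function `D + C (s I - A)⁻¹ B`; meaningful when `s` is not an eigenvalue of `A`. -/
def transfer (M : StateSpace n m) (s : ℂ) : Matrix (Fin m) (Fin m) ℂ :=
  M.D + M.C * (s • (1 : Matrix (Fin n) (Fin n) ℂ) - M.A)⁻¹ * M.B

/-- The two models realize the same rational transfer function: the values agree wherever
both are defined, that is, away from the finitely many eigenvalues of the two state matrices. -/
def SameTransfer (M : StateSpace n m) (M' : StateSpace k m) : Prop :=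
  ∀ s : ℂ, s ∉ spectrum ℂ M.A → s ∉ spectrum ℂ M'.A → M.transfer s = M'.transfer s

/-- Controllability of a pair: `rank [s I - A | B] = n` for all complex `s`. -/
def Controllable (A : Matrix (Fin n) (Fin n) ℂ) (B : Matrix (Fin n) (Fin m) ℂ) : Prop :=
  ∀ s : ℂ, (Matrix.fromCols (s • (1 : Matrix (Fin n) (Fin n) ℂ) - A) B).rank = n

/-- `(A, B)` is controllable and `(A, C)` is observable. -/
def Minimal (M : StateSpace n m) : Prop :=
  Controllable M.A M.B ∧ Controllable M.Aᴴ M.Cᴴ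

/-- Strict passivity: asymptotic stability (all eigenvalues of `A`, which are the poles of the
transfer function when the model is minimal, lie in the open left half plane), and positive
definiteness of `Φ(iω) = T(iω)ᴴ + T(iω)` for every real `ω` and for `ω = ∞`,
where `Φ(∞) = Dᴴ + D`. -/
def StrictlyPassive (M : StateSpace n m) : Prop :=
  (∀ z ∈ spectrum ℂ M.A, z.re < 0) ∧
  (∀ ω : ℝ, ((M.transfer (Complex.I * ω))ᴴ + M.transfer (Complex.I * ω)).PosDef) ∧
  (M.Dᴴ + M.D).PosDef

/-- The shifted model `{A + (ξ/2) I, B, C, D - (ξ/2) I}`, a realization of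
`T_ξ(s) = C ((s - ξ/2) I - A)⁻¹ B + D - (ξ/2) I`. -/
def shift (M : StateSpace n m) (ξ : ℝ) : StateSpace n m where
  A := M.A + ((ξ / 2 : ℝ) : ℂ) • (1 : Matrix (Fin n) (Fin n) ℂ)
  B := M.B
  C := M.C
  D := M.D - ((ξ / 2 : ℝ) : ℂ) • (1 : Matrix (Fin m) (Fin m) ℂ)

/-- `Ξ = sup {ξ | T_ξ is strictly passive}`. -/
def maxShift (M : StateSpace n m) : ℝ :=
  sSup {ξ : ℝ | (M.shift ξ).StrictlyPassive}

/-- The matrix `W(X, M)` of the passivity linear matrix inequality. -/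
def W (M : StateSpace n m) (X : Matrix (Fin n) (Fin n) ℂ) :
    Matrix (Fin n ⊕ Fin m) (Fin n ⊕ Fin m) ℂ :=
  Matrix.fromBlocks (-(M.Aᴴ * X) - X * M.A) (M.Cᴴ - X * M.B)
    (M.C - M.Bᴴ * X) (M.Dᴴ + M.D)

/-- The norm of the block matrix `[Δ_A Δ_B; Δ_C Δ_D]`: largest singular value (operator norm for
the Euclidean norms), or Frobenius norm. -/
def size (ν : NormKind) (Δ : StateSpace n m) : ℝ :=
  match ν with
  | .spectral =>
      ‖Matrix.toEuclideanCLM (𝕜 := ℂ) (Matrix.fromBlocks Δ.A Δ.B Δ.C Δ.D)‖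
  | .frobenius =>
      Real.sqrt (∑ i, ∑ j, ‖Matrix.fromBlocks Δ.A Δ.B Δ.C Δ.D i j‖ ^ 2)

/-- The `X`-passivity radius `inf {‖Δ‖ | det W(X, M + Δ) = 0}`, for `X > 0` with `W(X, M) > 0`. -/
def xPassivityRadius (ν : NormKind) (M : StateSpace n m) (X : Matrix (Fin n) (Fin n) ℂ) : ℝ≥0∞ :=
  ⨅ (Δ : StateSpace n m) (_ : ((M + Δ).W X).det = 0), ENNReal.ofReal (Δ.size ν)

/-- The passivity radius `ρ_M = sup_X inf {‖Δ‖ | det W(X, M + Δ) = 0}`, the supremum being over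
all `X > 0` with `W(X, M) > 0` (it is `0` when there is no such `X`). -/
def passivityRadius (ν : NormKind) (M : StateSpace n m) : ℝ≥0∞ :=
  ⨆ (X : Matrix (Fin n) (Fin n) ℂ) (_ : X.PosDef ∧ (M.W X).PosDef), xPassivityRadius ν M X

/-- The size of the smallest perturbation that destroys strict passivity of the model. -/
def passivityMargin (ν : NormKind) (M : StateSpace n m) : ℝ≥0∞ :=
  ⨅ (Δ : StateSpace n m) (_ : ¬ (M + Δ).StrictlyPassive), ENNReal.ofReal (Δ.size ν)

/-- The model in the new state `T x`, where `T'` is the inverse of `T`: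
`{T A T', T B, C T', D}`. -/
def transform (M : StateSpace n m) (T : Matrix (Fin k) (Fin n) ℂ)
    (T' : Matrix (Fin n) (Fin k) ℂ) : StateSpace k m :=
  ⟨T * M.A * T', T * M.B, M.C * T', M.D⟩

/-- The model is port-Hamiltonian with the given matrix `Q`:
`x' = (J - R) Q x + (G - K) u`, `y = (G + K)ᴴ Q x + (S + N) u` with `[J G; -Gᴴ N]`
skew-Hermitian, `[R K; Kᴴ S]` Hermitian positive semidefinite and `Q` Hermitian positive
definite. -/
def IsPortHamiltonian (M : StateSpace n m) (Q : Matrix (Fin n) (Fin n) ℂ) : Prop :=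
  Q.PosDef ∧
  ∃ (J R : Matrix (Fin n) (Fin n) ℂ) (G K : Matrix (Fin n) (Fin m) ℂ)
    (S N : Matrix (Fin m) (Fin m) ℂ),
    M.A = (J - R) * Q ∧ M.B = G - K ∧ M.C = (G + K)ᴴ * Q ∧ M.D = S + N ∧
    (Matrix.fromBlocks J G (-Gᴴ) N)ᴴ = -Matrix.fromBlocks J G (-Gᴴ) N ∧
    (Matrix.fromBlocks R K Kᴴ S).PosSemidef

end StateSpace

end

/-! Write `H` for the block matrix `[A B; C D]` and `P = diag(-X, I)`. Then `W(X, M) = P H + Hᴴ P`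
is twice the Hermitian part of `P H`, and `W(X, M_ξ) = W(X, M) - ξ diag(X, I)`. A perturbation that
makes `W` singular can be taken of rank one, so the spectral and the Frobenius norm give the same
radius, and `ρ_M(X) ≥ r` says that `2 r ‖P v‖ ‖v‖ ≤ vᴴ W(X, M) v` for all `v`. Since
`vᴴ diag(X, I) v ≤ ‖P v‖ ‖v‖`, with equality for `X = I`, the bound `ρ_M(X) ≥ ξ / 2` implies
`W(X, M_ξ) ≥ 0`, and for `X = I` it is equivalent to it.

For the upper bound, a vector that witnesses the failure of strict passivity of `M'_ξ` yields a rank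
one perturbation of `M'` of norm at most `ξ / 2` that destroys strict passivity; hence
`ρ_M' ≤ δ_M' ≤ Ξ / 2` for every realization `M'`. For the lower bound, the strict
Kalman-Yakubovich-Popov lemma (a separating hyperplane for the cone of the matrices `W(X, M_ξ)`,
whose normal decomposes frequency by frequency) solves `W(X, M_ξ) > 0` for every `ξ < Ξ`. Minimality
makes the set of solutions `X ≥ 0` of `W(X, M) ≥ 0` compact, so a solution survives at `ξ = Ξ`, and
the change of state by `T` with `X = Tᴴ T` turns it into `I`. The converse for minimal realizations
uses their similarity: the jointly reachable space of two of them is the graph of an isomorphism.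
-/

open Matrix Filter Topology
open WithLp (toLp)

section ReQuad

variable {ι κ : Type*} [Fintype ι] [Fintype κ]

/-- The real part of the quadratic form of a complex square matrix; for a Hermitian matrix this is
the whole quadratic form. -/
noncomputable def reQuad (H : Matrix ι ι ℂ) (v : ι → ℂ) : ℝ := (star v ⬝ᵥ H *ᵥ v).re

lemma reQuad_add (H K : Matrix ι ι ℂ) (v : ι → ℂ) :
    reQuad (H + K) v = reQuad H v + reQuad K v := by
  simp [reQuad, add_mulVec, dotProduct_add]

lemma reQuad_sub (H K : Matrix ι ι ℂ) (v : ι → ℂ) :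
    reQuad (H - K) v = reQuad H v - reQuad K v := by
  simp [reQuad, sub_mulVec, dotProduct_sub]

lemma reQuad_smul (t : ℝ) (H : Matrix ι ι ℂ) (v : ι → ℂ) :
    reQuad (t • H) v = t * reQuad H v := by
  simp [reQuad, smul_mulVec, dotProduct_smul]

lemma reQuad_conjTranspose (H : Matrix ι ι ℂ) (v : ι → ℂ) : reQuad Hᴴ v = reQuad H v := by
  have h : star v ⬝ᵥ Hᴴ *ᵥ v = star (star v ⬝ᵥ H *ᵥ v) := by
    rw [star_dotProduct, star_mulVec, ← dotProduct_mulVec, conjTranspose_conjTranspose]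
  simp [reQuad, h]

lemma reQuad_conjTranspose_add_self (H : Matrix ι ι ℂ) (v : ι → ℂ) :
    reQuad (Hᴴ + H) v = 2 * (star v ⬝ᵥ H *ᵥ v).re := by
  rw [reQuad_add, reQuad_conjTranspose, reQuad, two_mul]

lemma reQuad_smul_vec (H : Matrix ι ι ℂ) (c : ℂ) (v : ι → ℂ) :
    reQuad H (c • v) = ‖c‖ ^ 2 * reQuad H v := by
  have h : star (c • v) ⬝ᵥ H *ᵥ (c • v) = (‖c‖ ^ 2 : ℝ) * (star v ⬝ᵥ H *ᵥ v) := by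
    rw [mulVec_smul, star_smul, smul_dotProduct, dotProduct_smul, smul_smul, smul_eq_mul,
      Complex.ofReal_pow, ← Complex.conj_mul']
    rfl
  rw [reQuad, h, Complex.re_ofReal_mul, reQuad]

lemma reQuad_conjTranspose_mul_mul (H : Matrix ι ι ℂ) (T : Matrix ι κ ℂ) (v : κ → ℂ) :
    reQuad (Tᴴ * H * T) v = reQuad H (T *ᵥ v) := by
  rw [reQuad, reQuad, star_mulVec, ← dotProduct_mulVec, mulVec_mulVec, mulVec_mulVec,
    Matrix.mul_assoc]

lemma star_dotProduct_self_eq_norm_sq (v : ι → ℂ) :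
    star v ⬝ᵥ v = ((‖toLp 2 v‖ ^ 2 : ℝ) : ℂ) := by
  rw [dotProduct_comm, ← EuclideanSpace.inner_toLp_toLp, inner_self_eq_norm_sq_to_K]
  simp

lemma reQuad_one [DecidableEq ι] (v : ι → ℂ) :
    reQuad (1 : Matrix ι ι ℂ) v = ‖toLp 2 v‖ ^ 2 := by
  rw [reQuad, one_mulVec, star_dotProduct_self_eq_norm_sq, Complex.ofReal_re]

lemma norm_toLp_pos {v : ι → ℂ} (hv : v ≠ 0) : 0 < ‖toLp 2 v‖ := by
  simpa using hv

lemma norm_star_dotProduct_le (w v : ι → ℂ) :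
    ‖star w ⬝ᵥ v‖ ≤ ‖toLp 2 w‖ * ‖toLp 2 v‖ := by
  rw [dotProduct_comm, ← EuclideanSpace.inner_toLp_toLp]
  exact norm_inner_le_norm _ _

lemma star_dotProduct_mulVec_eq_reQuad {H : Matrix ι ι ℂ} (hH : H.IsHermitian) (v : ι → ℂ) :
    star v ⬝ᵥ H *ᵥ v = (reQuad H v : ℂ) :=
  Complex.ext (by simp [reQuad]) (by simpa using hH.im_star_dotProduct_mulVec_self v)

lemma posDef_iff_reQuad {H : Matrix ι ι ℂ} (hH : H.IsHermitian) :
    H.PosDef ↔ ∀ v, v ≠ 0 → 0 < reQuad H v := by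
  simp only [posDef_iff_dotProduct_mulVec, hH, true_and, star_dotProduct_mulVec_eq_reQuad hH,
    Complex.zero_lt_real, ne_eq]

lemma posSemidef_iff_reQuad {H : Matrix ι ι ℂ} (hH : H.IsHermitian) :
    H.PosSemidef ↔ ∀ v, 0 ≤ reQuad H v := by
  simp only [posSemidef_iff_dotProduct_mulVec, hH, true_and, star_dotProduct_mulVec_eq_reQuad hH,
    Complex.zero_le_real]

lemma reQuad_pos {H : Matrix ι ι ℂ} (hH : H.PosDef) {v : ι → ℂ} (hv : v ≠ 0) : 0 < reQuad H v :=
  (posDef_iff_reQuad hH.1).1 hH v hv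

lemma reQuad_nonneg {H : Matrix ι ι ℂ} (hH : H.PosSemidef) (v : ι → ℂ) : 0 ≤ reQuad H v :=
  (posSemidef_iff_reQuad hH.1).1 hH v

lemma mulVec_eq_zero_of_reQuad_eq_zero {H : Matrix ι ι ℂ} (hH : H.PosSemidef) {v : ι → ℂ}
    (hv : reQuad H v = 0) : H *ᵥ v = 0 := by
  classical
  rw [← hH.dotProduct_mulVec_zero_iff, star_dotProduct_mulVec_eq_reQuad hH.1, hv,
    Complex.ofReal_zero]

lemma continuous_reQuad : Continuous fun p : Matrix ι ι ℂ × (ι → ℂ) => reQuad p.1 p.2 := by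
  unfold reQuad
  fun_prop

lemma isOpen_setOf_reQuad_pos : IsOpen {H : Matrix ι ι ℂ | ∀ v, v ≠ 0 → 0 < reQuad H v} := by
  refine isOpen_iff_mem_nhds.2 fun H hH => ?_
  have hsphere : ∀ᶠ K in 𝓝 H, ∀ v ∈ Metric.sphere (0 : ι → ℂ) 1, 0 < reQuad K v :=
    (isCompact_sphere (0 : ι → ℂ) 1).eventually_forall_of_forall_eventually fun v hv =>
      continuous_reQuad.continuousAt.eventually_const_lt
        (hH v (ne_zero_of_mem_unit_sphere ⟨v, hv⟩))
  filter_upwards [hsphere] with K hK v hv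
  have hnormalized := hK (((‖v‖⁻¹ : ℝ) : ℂ) • v) (by simp [norm_smul, hv])
  rw [reQuad_smul_vec] at hnormalized
  exact pos_of_mul_pos_right hnormalized (by positivity)

lemma isClosed_setOf_posSemidef {ι : Type*} [Finite ι] :
    IsClosed {H : Matrix ι ι ℂ | H.PosSemidef} := by
  have := Fintype.ofFinite ι
  have hset : {H : Matrix ι ι ℂ | H.PosSemidef} = {H | Hᴴ = H} ∩ ⋂ v, {H | 0 ≤ reQuad H v} := by
    ext H
    simp only [Set.mem_ofPred_eq, Set.mem_inter_iff, Set.mem_iInter]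
    exact ⟨fun h => ⟨h.1, reQuad_nonneg h⟩, fun h => (posSemidef_iff_reQuad h.1).2 h.2⟩
  rw [hset]
  refine (isClosed_eq (by fun_prop) continuous_id).inter (isClosed_iInter fun v => ?_)
  exact isClosed_le continuous_const (continuous_reQuad.comp (.prodMk_left v))

lemma exists_det_eq_zero_of_not_posDef [DecidableEq ι] {H K : Matrix ι ι ℂ} (hH : H.PosDef)
    (hK : K.IsHermitian) (hHK : ¬ (H + K).PosDef) :
    ∃ t ∈ Set.Icc (0 : ℝ) 1, (H + t • K).det = 0 := by
  by_contra! hdet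
  have hcont : Continuous fun t : ℝ => H + t • K := by fun_prop
  have hherm (t : ℝ) : (H + t • K).IsHermitian := hH.1.add (hK.smul (IsSelfAdjoint.all t))
  -- Positive definiteness is an open condition on the segment; nonsingularity makes it closed too.
  have hcover : Set.Icc (0 : ℝ) 1 ⊆ (fun t : ℝ => H + t • K) ⁻¹' {L | ∀ v, v ≠ 0 → 0 < reQuad L v} ∪
      (fun t : ℝ => H + t • K) ⁻¹' {L | L.PosSemidef}ᶜ := by
    intro t ht
    rw [Set.mem_union, or_iff_not_imp_right]
    intro hpsd
    have hpsd : (H + t • K).PosSemidef := not_not.1 hpsd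
    have hunit : IsUnit (H + t • K) := (isUnit_iff_isUnit_det _).2 (hdet t ht).isUnit
    exact fun v hv => reQuad_pos (hpsd.posDef_iff_isUnit.2 hunit) hv
  have hdisj : Disjoint ((fun t : ℝ => H + t • K) ⁻¹' {L | ∀ v, v ≠ 0 → 0 < reQuad L v})
      ((fun t : ℝ => H + t • K) ⁻¹' {L | L.PosSemidef}ᶜ) :=
    Set.disjoint_left.2 fun t ht hnot => hnot ((posDef_iff_reQuad (hherm t)).2 ht).posSemidef
  have hall := isPreconnected_Icc.subset_left_of_subset_union
    (isOpen_setOf_reQuad_pos.preimage hcont) (isClosed_setOf_posSemidef.isOpen_compl.preimage hcont)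
    hdisj hcover ⟨0, by simp, fun v hv => by simpa using reQuad_pos hH hv⟩
  refine hHK ((posDef_iff_reQuad (hH.1.add hK)).2 fun v hv => ?_)
  simpa using hall (Set.right_mem_Icc.2 zero_le_one) v hv

end ReQuad

lemma norm_toEuclideanCLM_le_frobenius {ι : Type*} [Fintype ι] [DecidableEq ι] (N : Matrix ι ι ℂ) :
    ‖toEuclideanCLM (𝕜 := ℂ) N‖ ≤ √(∑ i, ∑ j, ‖N i j‖ ^ 2) := by
  refine ContinuousLinearMap.opNorm_le_bound _ (Real.sqrt_nonneg _) fun v => ?_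
  have hrow (i : ι) : ‖(toEuclideanCLM (𝕜 := ℂ) N v) i‖ ≤ ∑ j, ‖N i j‖ * ‖v j‖ := by
    rw [ofLp_toEuclideanCLM]
    exact (norm_sum_le _ _).trans_eq (by simp)
  refine le_of_sq_le_sq ?_ (by positivity)
  rw [mul_pow, Real.sq_sqrt (by positivity), EuclideanSpace.norm_sq_eq, EuclideanSpace.norm_sq_eq,
    Finset.sum_mul]
  gcongr with i
  calc _ ≤ (∑ j, ‖N i j‖ * ‖v j‖) ^ 2 := by gcongr; exact hrow i
    _ ≤ _ := Finset.sum_mul_sq_le_sq_mul_sq ..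

namespace StateSpace

variable {n m : ℕ}

section Size

/-- The block matrix `[A B; C D]` of a model, which maps a state and an input to the derivative of
the state and the output. -/
def mat (M : StateSpace n m) : Matrix (Fin n ⊕ Fin m) (Fin n ⊕ Fin m) ℂ :=
  fromBlocks M.A M.B M.C M.D

/-- The model with a given block matrix `[A B; C D]`; the inverse of `mat`. -/
def ofMat (N : Matrix (Fin n ⊕ Fin m) (Fin n ⊕ Fin m) ℂ) : StateSpace n m :=
  ⟨N.toBlocks₁₁, N.toBlocks₁₂, N.toBlocks₂₁, N.toBlocks₂₂⟩

lemma mat_ofMat (N : Matrix (Fin n ⊕ Fin m) (Fin n ⊕ Fin m) ℂ) : (ofMat N).mat = N :=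
  fromBlocks_toBlocks N

lemma mat_add (M N : StateSpace n m) : (M + N).mat = M.mat + N.mat :=
  (fromBlocks_add ..).symm

lemma size_spectral (Δ : StateSpace n m) :
    Δ.size .spectral = ‖toEuclideanCLM (𝕜 := ℂ) Δ.mat‖ := rfl

lemma size_frobenius (Δ : StateSpace n m) :
    Δ.size .frobenius = √(∑ i, ∑ j, ‖Δ.mat i j‖ ^ 2) := rfl

lemma norm_toEuclideanCLM_mat_le_size (ν : NormKind) (Δ : StateSpace n m) :
    ‖toEuclideanCLM (𝕜 := ℂ) Δ.mat‖ ≤ Δ.size ν := by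
  cases ν
  · exact le_rfl
  · exact norm_toEuclideanCLM_le_frobenius _

lemma size_le_frobenius (ν : NormKind) (Δ : StateSpace n m) :
    Δ.size ν ≤ √(∑ i, ∑ j, ‖Δ.mat i j‖ ^ 2) := by
  cases ν
  · exact norm_toEuclideanCLM_le_frobenius _
  · exact le_rfl

lemma size_nonneg (ν : NormKind) (Δ : StateSpace n m) : 0 ≤ Δ.size ν :=
  (norm_nonneg _).trans (norm_toEuclideanCLM_mat_le_size ν Δ)

lemma size_ofMat_smul (ν : NormKind) (t : ℝ) (Δ : StateSpace n m) :
    (ofMat (t • Δ.mat)).size ν = |t| * Δ.size ν := by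
  cases ν
  · rw [size_spectral, size_spectral, mat_ofMat, ← Complex.coe_smul t Δ.mat, map_smul, norm_smul,
      Complex.norm_real, Real.norm_eq_abs]
  · rw [size_frobenius, size_frobenius, mat_ofMat, ← Real.sqrt_sq_eq_abs,
      ← Real.sqrt_mul (sq_nonneg t)]
    simp only [Finset.mul_sum, Matrix.smul_apply, norm_smul, Real.norm_eq_abs, mul_pow, sq_abs]

lemma norm_star_dotProduct_mat_mulVec_le (ν : NormKind) (Δ : StateSpace n m)
    (w v : Fin n ⊕ Fin m → ℂ) :
    ‖star w ⬝ᵥ Δ.mat *ᵥ v‖ ≤ Δ.size ν * (‖toLp 2 w‖ * ‖toLp 2 v‖) := by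
  have hv : ‖toLp 2 (Δ.mat *ᵥ v)‖ ≤ Δ.size ν * ‖toLp 2 v‖ := by
    rw [← toEuclideanCLM_toLp]
    exact ContinuousLinearMap.le_of_opNorm_le _ (norm_toEuclideanCLM_mat_le_size ν Δ) _
  calc _ ≤ ‖toLp 2 w‖ * ‖toLp 2 (Δ.mat *ᵥ v)‖ := norm_star_dotProduct_le _ _
    _ ≤ ‖toLp 2 w‖ * (Δ.size ν * ‖toLp 2 v‖) := by gcongr
    _ = _ := by ring

lemma size_ofMat_vecMulVec_le (ν : NormKind) (w v : Fin n ⊕ Fin m → ℂ) :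
    (ofMat (vecMulVec w (star v)) : StateSpace n m).size ν ≤ ‖toLp 2 w‖ * ‖toLp 2 v‖ := by
  refine (size_le_frobenius ν _).trans_eq ?_
  rw [Real.sqrt_eq_iff_eq_sq (by positivity) (by positivity), mul_pow,
    EuclideanSpace.norm_sq_eq, EuclideanSpace.norm_sq_eq, Finset.sum_mul_sum]
  simp [mat_ofMat, vecMulVec_apply, mul_pow]

/- The rank one matrix `w vᴴ / ‖v‖²` has the same spectral and Frobenius norm, so extremal
perturbations are the same for both norms. -/
lemma exists_mat_mulVec_eq (ν : NormKind) {v : Fin n ⊕ Fin m → ℂ} (hv : v ≠ 0)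
    (w : Fin n ⊕ Fin m → ℂ) :
    ∃ Δ : StateSpace n m, Δ.mat *ᵥ v = w ∧ Δ.size ν * ‖toLp 2 v‖ ≤ ‖toLp 2 w‖ := by
  have hpos := norm_toLp_pos hv
  have hself : star v ⬝ᵥ v ≠ 0 := by
    rw [star_dotProduct_self_eq_norm_sq]
    exact_mod_cast (pow_pos hpos 2).ne'
  refine ⟨ofMat (vecMulVec ((star v ⬝ᵥ v)⁻¹ • w) (star v)), ?_, ?_⟩
  · rw [mat_ofMat, vecMulVec_mulVec, op_smul_eq_smul, smul_inv_smul₀ hself]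
  · calc _ ≤ ‖toLp 2 ((star v ⬝ᵥ v)⁻¹ • w)‖ * ‖toLp 2 v‖ * ‖toLp 2 v‖ := by
          gcongr
          exact size_ofMat_vecMulVec_le ν _ _
      _ = ‖toLp 2 w‖ := by
          rw [WithLp.toLp_smul, norm_smul, norm_inv, star_dotProduct_self_eq_norm_sq,
            Complex.norm_real, Real.norm_of_nonneg (by positivity)]
          field_simp

end Size

section Weight

/-- The matrix `diag (-X, I)`, for which `W(X, M)` is twice the Hermitian part of
`diag (-X, I) * [A B; C D]`. -/
def signedWeight (m : ℕ) (X : Matrix (Fin n) (Fin n) ℂ) :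
    Matrix (Fin n ⊕ Fin m) (Fin n ⊕ Fin m) ℂ :=
  fromBlocks (-X) 0 0 1

variable {X : Matrix (Fin n) (Fin n) ℂ}

lemma isHermitian_signedWeight (hX : X.IsHermitian) : (signedWeight m X).IsHermitian :=
  isHermitian_fromBlocks_iff.2 ⟨hX.neg, by simp, by simp, isHermitian_one⟩

lemma W_eq (M : StateSpace n m) (hX : X.IsHermitian) :
    M.W X = signedWeight m X * M.mat + (signedWeight m X * M.mat)ᴴ := by
  simp only [W, signedWeight, mat, fromBlocks_multiply, fromBlocks_conjTranspose, fromBlocks_add,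
    conjTranspose_mul, conjTranspose_neg, hX.eq, Matrix.zero_mul, Matrix.one_mul, zero_add,
    add_zero, Matrix.neg_mul, sub_eq_add_neg]
  congr 1 <;> exact add_comm _ _

lemma isHermitian_W (M : StateSpace n m) (hX : X.IsHermitian) : (M.W X).IsHermitian := by
  rw [M.W_eq hX]
  exact isHermitian_add_transpose_self _

lemma W_add (M Δ : StateSpace n m) (hX : X.IsHermitian) :
    (M + Δ).W X = M.W X + (signedWeight m X * Δ.mat + (signedWeight m X * Δ.mat)ᴴ) := by
  rw [W_eq _ hX, W_eq _ hX, mat_add, mul_add, conjTranspose_add]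
  abel

lemma reQuad_W (M : StateSpace n m) (hX : X.IsHermitian) (v : Fin n ⊕ Fin m → ℂ) :
    reQuad (M.W X) v = 2 * (star (signedWeight m X *ᵥ v) ⬝ᵥ M.mat *ᵥ v).re := by
  rw [W_eq M hX, reQuad_add, reQuad_conjTranspose, reQuad, star_mulVec,
    (isHermitian_signedWeight hX).eq, ← dotProduct_mulVec, mulVec_mulVec]
  ring

lemma reQuad_W_add (M Δ : StateSpace n m) (hX : X.IsHermitian) (v : Fin n ⊕ Fin m → ℂ) :
    reQuad ((M + Δ).W X) v =
      reQuad (M.W X) v + 2 * (star (signedWeight m X *ᵥ v) ⬝ᵥ Δ.mat *ᵥ v).re := by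
  rw [reQuad_W _ hX, reQuad_W _ hX, mat_add, add_mulVec, dotProduct_add, Complex.add_re, mul_add]

lemma signedWeight_mulVec_ne_zero (hX : X.PosDef) {v : Fin n ⊕ Fin m → ℂ} (hv : v ≠ 0) :
    signedWeight m X *ᵥ v ≠ 0 := by
  refine fun h => hv (eq_zero_of_mulVec_eq_zero ?_ h)
  rw [signedWeight, det_fromBlocks_zero₂₁, det_neg, det_one, mul_one]
  exact mul_ne_zero (by simp) hX.det_pos.ne'

lemma xPassivityRadius_le_size (ν : NormKind) {M Δ : StateSpace n m} (hX : X.PosDef)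
    (hW : (M.W X).PosDef) (hΔ : ¬ ((M + Δ).W X).PosDef) :
    M.xPassivityRadius ν X ≤ ENNReal.ofReal (Δ.size ν) := by
  rw [W_add _ _ hX.1] at hΔ
  obtain ⟨t, ht, hdet⟩ :=
    exists_det_eq_zero_of_not_posDef hW (isHermitian_add_transpose_self _) hΔ
  have hsingular : ((M + ofMat (t • Δ.mat)).W X).det = 0 := by
    rw [W_add _ _ hX.1, mat_ofMat, Matrix.mul_smul, conjTranspose_smul, star_trivial,
      ← smul_add, hdet]
  refine (iInf₂_le (ofMat (t • Δ.mat)) hsingular).trans (ENNReal.ofReal_le_ofReal ?_)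
  rw [size_ofMat_smul, abs_of_nonneg ht.1]
  exact mul_le_of_le_one_left (size_nonneg ν Δ) ht.2

lemma ofReal_le_xPassivityRadius (ν : NormKind) {M : StateSpace n m} (hX : X.PosDef) {r : ℝ}
    (h : ∀ v, 2 * r * (‖toLp 2 (signedWeight m X *ᵥ v)‖ * ‖toLp 2 v‖) ≤ reQuad (M.W X) v) :
    ENNReal.ofReal r ≤ M.xPassivityRadius ν X := by
  refine le_iInf₂ fun Δ hΔ => ENNReal.ofReal_le_ofReal ?_
  obtain ⟨v, hv, hker⟩ := exists_mulVec_eq_zero_iff.2 hΔ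
  have hquad := reQuad_W_add M Δ hX.1 v
  rw [reQuad, hker, dotProduct_zero, Complex.zero_re] at hquad
  have hbound := neg_le_of_abs_le ((Complex.abs_re_le_norm _).trans
    (norm_star_dotProduct_mat_mulVec_le ν Δ (signedWeight m X *ᵥ v) v))
  have hpos := mul_pos (norm_toLp_pos (signedWeight_mulVec_ne_zero hX hv)) (norm_toLp_pos hv)
  exact le_of_mul_le_mul_right (by linarith [h v]) hpos

/- For `y = diag (-X, I) v`, the rank one perturbation that maps `v` to `-(vᴴ W v / (2 ‖y‖²)) y`
makes the quadratic form vanish at `v`. -/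
lemma le_reQuad_of_ofReal_le_xPassivityRadius (ν : NormKind) {M : StateSpace n m}
    (hX : X.PosDef) (hW : (M.W X).PosDef) {r : ℝ}
    (h : ENNReal.ofReal r ≤ M.xPassivityRadius ν X) (v : Fin n ⊕ Fin m → ℂ) :
    2 * r * (‖toLp 2 (signedWeight m X *ᵥ v)‖ * ‖toLp 2 v‖) ≤ reQuad (M.W X) v := by
  obtain rfl | hv := eq_or_ne v 0
  · simp [reQuad]
  set y := signedWeight m X *ᵥ v with hy
  have hy_pos : 0 < ‖toLp 2 y‖ := norm_toLp_pos (signedWeight_mulVec_ne_zero hX hv)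
  have hW_pos := reQuad_pos hW hv
  obtain ⟨Δ, hΔ, hsize⟩ := exists_mat_mulVec_eq (m := m) ν hv
    (((-(reQuad (M.W X) v / (2 * ‖toLp 2 y‖ ^ 2)) : ℝ) : ℂ) • y)
  have hquad : reQuad ((M + Δ).W X) v = 0 := by
    rw [reQuad_W_add M Δ hX.1, ← hy, hΔ, dotProduct_smul, star_dotProduct_self_eq_norm_sq,
      smul_eq_mul, ← Complex.ofReal_mul, Complex.ofReal_re]
    field_simp
    ring
  rw [WithLp.toLp_smul, norm_smul, Complex.norm_real, norm_neg,
    Real.norm_of_nonneg (by positivity)] at hsize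
  have hr : r ≤ Δ.size ν := (ENNReal.ofReal_le_ofReal_iff (size_nonneg ν Δ)).1
    (h.trans (xPassivityRadius_le_size ν hX hW fun hpos => (reQuad_pos hpos hv).ne' hquad))
  calc 2 * r * (‖toLp 2 y‖ * ‖toLp 2 v‖) = 2 * ‖toLp 2 y‖ * (r * ‖toLp 2 v‖) := by ring
    _ ≤ 2 * ‖toLp 2 y‖ * (Δ.size ν * ‖toLp 2 v‖) := by gcongr
    _ ≤ 2 * ‖toLp 2 y‖ * (reQuad (M.W X) v / (2 * ‖toLp 2 y‖ ^ 2) * ‖toLp 2 y‖) := by gcongr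
    _ = reQuad (M.W X) v := by field_simp

end Weight

end StateSpace

section Spectrum

variable {ι : Type*} [Fintype ι] [DecidableEq ι] {A : Matrix ι ι ℂ} {s : ℂ}

lemma mem_spectrum_iff_exists_mulVec : s ∈ spectrum ℂ A ↔ ∃ q, q ≠ 0 ∧ A *ᵥ q = s • q := by
  rw [spectrum.mem_iff, isUnit_iff_isUnit_det, isUnit_iff_ne_zero, not_not,
    ← exists_mulVec_eq_zero_iff]
  refine exists_congr fun q => and_congr_right fun _ => ?_
  rw [sub_mulVec, Algebra.algebraMap_eq_smul_one, smul_mulVec, one_mulVec, sub_eq_zero, eq_comm]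

lemma eq_zero_of_mulVec_eq_smul (hs : s ∉ spectrum ℂ A) {q : ι → ℂ} (hq : A *ᵥ q = s • q) :
    q = 0 := by
  by_contra hq0
  exact hs (mem_spectrum_iff_exists_mulVec.2 ⟨q, hq0, hq⟩)

lemma isUnit_det_smul_one_sub (hs : s ∉ spectrum ℂ A) :
    IsUnit (s • (1 : Matrix ι ι ℂ) - A).det := by
  rw [← isUnit_iff_isUnit_det, ← Algebra.algebraMap_eq_smul_one]
  exact not_not.1 hs

end Spectrum

lemma eq_zero_of_comp_inl_inr {α β R : Type*} [Zero R] {v : α ⊕ β → R} (hinl : v ∘ Sum.inl = 0)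
    (hinr : v ∘ Sum.inr = 0) : v = 0 := by
  ext (i | i)
  exacts [congrFun hinl i, congrFun hinr i]

namespace StateSpace

variable {n m : ℕ}

lemma mat_mulVec_inl (M : StateSpace n m) (v : Fin n ⊕ Fin m → ℂ) :
    (M.mat *ᵥ v) ∘ Sum.inl = M.A *ᵥ (v ∘ Sum.inl) + M.B *ᵥ (v ∘ Sum.inr) := by
  rw [mat, fromBlocks_mulVec, Sum.elim_comp_inl]

lemma mat_mulVec_inr (M : StateSpace n m) (v : Fin n ⊕ Fin m → ℂ) :
    (M.mat *ᵥ v) ∘ Sum.inr = M.C *ᵥ (v ∘ Sum.inl) + M.D *ᵥ (v ∘ Sum.inr) := by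
  rw [mat, fromBlocks_mulVec, Sum.elim_comp_inr]

section Transfer

variable (M : StateSpace n m) {s : ℂ} {u : Fin m → ℂ}

lemma exists_state_eq (hs : s ∉ spectrum ℂ M.A) (u : Fin m → ℂ) :
    ∃ q, M.A *ᵥ q + M.B *ᵥ u = s • q := by
  refine ⟨(s • (1 : Matrix (Fin n) (Fin n) ℂ) - M.A)⁻¹ *ᵥ (M.B *ᵥ u), ?_⟩
  rw [← eq_sub_iff_add_eq', ← one_mulVec (s • _), mulVec_smul, ← smul_mulVec, ← sub_mulVec,
    mulVec_mulVec, mul_nonsing_inv _ (isUnit_det_smul_one_sub hs), one_mulVec]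

lemma transfer_mulVec (hs : s ∉ spectrum ℂ M.A) {q : Fin n → ℂ}
    (hq : M.A *ᵥ q + M.B *ᵥ u = s • q) :
    M.transfer s *ᵥ u = M.C *ᵥ q + M.D *ᵥ u := by
  have hBu : M.B *ᵥ u = (s • (1 : Matrix (Fin n) (Fin n) ℂ) - M.A) *ᵥ q := by
    rw [sub_mulVec, smul_mulVec, one_mulVec, ← hq, add_sub_cancel_left]
  rw [transfer, add_mulVec, ← mulVec_mulVec, ← mulVec_mulVec, hBu, mulVec_mulVec q,
    nonsing_inv_mul _ (isUnit_det_smul_one_sub hs), one_mulVec, add_comm]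

end Transfer

section StrictlyPassive

variable {M : StateSpace n m}

/-- A pair `v = (q, u)`, `y = (a, b)` showing that no model with `M.mat *ᵥ v = y` is strictly
passive: `q` is an eigenvector of `A` for an eigenvalue in the closed right half plane, or `u` is a
direction in which the Hermitian part of the transfer function is not positive at a finite
frequency, or at infinity. -/
def Obstruction (v y : Fin n ⊕ Fin m → ℂ) : Prop :=
  (∃ s : ℂ, 0 ≤ s.re ∧ y ∘ Sum.inl = s • (v ∘ Sum.inl) ∧ v ∘ Sum.inr = 0) ∨
  (∃ ω : ℝ, y ∘ Sum.inl = (Complex.I * ω) • (v ∘ Sum.inl) ∧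
    (star (v ∘ Sum.inr) ⬝ᵥ (y ∘ Sum.inr)).re ≤ 0) ∨
  (v ∘ Sum.inl = 0 ∧ (star (v ∘ Sum.inr) ⬝ᵥ (y ∘ Sum.inr)).re ≤ 0)

lemma StrictlyPassive.I_mul_notMem_spectrum (h : M.StrictlyPassive) (ω : ℝ) :
    Complex.I * ω ∉ spectrum ℂ M.A :=
  fun hω => (h.1 _ hω).ne (by simp)

theorem StrictlyPassive.not_obstruction (h : M.StrictlyPassive) {v : Fin n ⊕ Fin m → ℂ}
    (hv : v ≠ 0) : ¬ Obstruction v (M.mat *ᵥ v) := by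
  rw [Obstruction, mat_mulVec_inl, mat_mulVec_inr]
  rintro (⟨s, hs, hq, hu⟩ | ⟨ω, hq, hre⟩ | ⟨hq, hre⟩)
  · rw [hu, mulVec_zero, add_zero] at hq
    have hs' : s ∉ spectrum ℂ M.A := fun h' => (h.1 s h').not_ge hs
    exact hv (eq_zero_of_comp_inl_inr (eq_zero_of_mulVec_eq_smul hs' hq) hu)
  · rw [← transfer_mulVec M (h.I_mul_notMem_spectrum ω) hq] at hre
    by_cases hu : v ∘ Sum.inr = 0
    · rw [hu, mulVec_zero, add_zero] at hq
      have hq0 := eq_zero_of_mulVec_eq_smul (h.I_mul_notMem_spectrum ω) hq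
      exact hv (eq_zero_of_comp_inl_inr hq0 hu)
    · have hpos := reQuad_pos (h.2.1 ω) hu
      rw [reQuad_conjTranspose_add_self] at hpos
      linarith
  · have hpos := reQuad_pos h.2.2 fun hu => hv (eq_zero_of_comp_inl_inr hq hu)
    rw [reQuad_conjTranspose_add_self] at hpos
    rw [hq, mulVec_zero, zero_add] at hre
    linarith

theorem strictlyPassive_of_not_obstruction (h : ∀ v, v ≠ 0 → ¬ Obstruction v (M.mat *ᵥ v)) :
    M.StrictlyPassive := by
  have hobs (q : Fin n → ℂ) (u : Fin m → ℂ) (hqu : q ≠ 0 ∨ u ≠ 0) : ¬ Obstruction (Sum.elim q u)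
      (Sum.elim (M.A *ᵥ q + M.B *ᵥ u) (M.C *ᵥ q + M.D *ᵥ u)) := by
    have hmat := fromBlocks_mulVec M.A M.B M.C M.D (Sum.elim q u)
    rw [Sum.elim_comp_inl, Sum.elim_comp_inr] at hmat
    rw [← hmat]
    exact h _ fun h0 => hqu.elim (· (by simpa using congrArg (· ∘ Sum.inl) h0))
      (· (by simpa using congrArg (· ∘ Sum.inr) h0))
  have hstable : ∀ s ∈ spectrum ℂ M.A, s.re < 0 := by
    intro s hs
    by_contra! hre
    obtain ⟨q, hq0, hq⟩ := mem_spectrum_iff_exists_mulVec.1 hs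
    exact hobs q 0 (.inl hq0) (.inl ⟨s, hre, by simp [hq], by simp⟩)
  refine ⟨hstable, fun ω => ?_, ?_⟩
  · refine (posDef_iff_reQuad (isHermitian_transpose_add_self _)).2 fun u hu => ?_
    have hω : Complex.I * ω ∉ spectrum ℂ M.A := fun h' => (hstable _ h').ne (by simp)
    obtain ⟨q, hq⟩ := M.exists_state_eq hω u
    rw [reQuad_conjTranspose_add_self, transfer_mulVec M hω hq]
    by_contra! hre
    exact hobs q u (.inr hu)
      (.inr (.inl ⟨ω, by simpa using hq, by
        simp only [Sum.elim_comp_inr]; linarith⟩))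
  · refine (posDef_iff_reQuad (isHermitian_transpose_add_self _)).2 fun u hu => ?_
    rw [reQuad_conjTranspose_add_self]
    by_contra! hre
    exact hobs 0 u (.inr hu)
      (.inr (.inr ⟨by simp, by simp only [Sum.elim_comp_inr, mulVec_zero, zero_add]; linarith⟩))

theorem strictlyPassive_iff_not_obstruction :
    M.StrictlyPassive ↔ ∀ v, v ≠ 0 → ¬ Obstruction v (M.mat *ᵥ v) :=
  ⟨fun h _ => h.not_obstruction, strictlyPassive_of_not_obstruction⟩

lemma reQuad_W_eq_inr_sub_inl (M : StateSpace n m) {X : Matrix (Fin n) (Fin n) ℂ}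
    (hX : X.IsHermitian) (v : Fin n ⊕ Fin m → ℂ) :
    reQuad (M.W X) v = 2 * ((star (v ∘ Sum.inr) ⬝ᵥ ((M.mat *ᵥ v) ∘ Sum.inr)).re -
      (star (v ∘ Sum.inl) ⬝ᵥ X *ᵥ ((M.mat *ᵥ v) ∘ Sum.inl)).re) := by
  have hmove : star (v ∘ Sum.inl) ⬝ᵥ X *ᵥ ((M.mat *ᵥ v) ∘ Sum.inl) =
      star (X *ᵥ (v ∘ Sum.inl)) ⬝ᵥ ((M.mat *ᵥ v) ∘ Sum.inl) := by
    rw [star_mulVec, ← dotProduct_mulVec, hX.eq]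
  rw [hmove, reQuad_W _ hX, signedWeight, fromBlocks_mulVec]
  simp only [neg_mulVec, zero_mulVec, add_zero, zero_add, one_mulVec, dotProduct,
    Fintype.sum_sum_type, Pi.star_apply, Sum.elim_inl, Sum.elim_inr, Function.comp_apply,
    Pi.neg_apply, star_neg, neg_mul, Finset.sum_neg_distrib, Complex.add_re, Complex.neg_re]
  ring

theorem strictlyPassive_of_posDef_W {X : Matrix (Fin n) (Fin n) ℂ} (hX : X.PosDef)
    (hW : (M.W X).PosDef) : M.StrictlyPassive := by
  refine strictlyPassive_of_not_obstruction fun v hv h => ?_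
  have hpos := reQuad_pos hW hv
  rw [reQuad_W_eq_inr_sub_inl M hX.1] at hpos
  have hscale (s : ℂ) : (star (v ∘ Sum.inl) ⬝ᵥ X *ᵥ (s • (v ∘ Sum.inl))).re =
      s.re * reQuad X (v ∘ Sum.inl) := by
    rw [mulVec_smul, dotProduct_smul, star_dotProduct_mulVec_eq_reQuad hX.1, smul_eq_mul,
      Complex.re_mul_ofReal]
  rcases h with ⟨s, hs, hq, hu⟩ | ⟨ω, hq, hre⟩ | ⟨hq, hre⟩
  · rw [hq, hscale, hu, star_zero, zero_dotProduct, Complex.zero_re] at hpos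
    linarith [mul_nonneg hs (reQuad_nonneg hX.posSemidef (v ∘ Sum.inl))]
  · rw [hq, hscale, Complex.re_mul_ofReal, Complex.I_re, zero_mul, zero_mul] at hpos
    linarith
  · rw [hq, star_zero, zero_dotProduct, Complex.zero_re] at hpos
    linarith

theorem passivityRadius_le_passivityMargin (ν : NormKind) (M : StateSpace n m) :
    M.passivityRadius ν ≤ M.passivityMargin ν :=
  iSup₂_le fun _ hX => le_iInf₂ fun _ hΔ =>
    xPassivityRadius_le_size ν hX.1 hX.2 fun h => hΔ (strictlyPassive_of_posDef_W hX.1 h)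

lemma mat_shift_mulVec (M : StateSpace n m) (ξ : ℝ) (v : Fin n ⊕ Fin m → ℂ) :
    (M.shift ξ).mat *ᵥ v = M.mat *ᵥ v +
      ((ξ / 2 : ℝ) : ℂ) • Sum.elim (v ∘ Sum.inl) (-(v ∘ Sum.inr)) := by
  simp only [mat, shift, fromBlocks_mulVec, add_mulVec, sub_mulVec, smul_mulVec, one_mulVec]
  ext (i | i)
  · simp [add_right_comm]
  · simp [sub_eq_add_neg, add_assoc]

/- An obstruction `v` for the shifted model is also one for the unshifted model perturbed by a rank
one matrix that agrees with the shift on `v`. -/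
theorem passivityMargin_le_of_not_strictlyPassive_shift (ν : NormKind) {ξ : ℝ} (hξ : 0 ≤ ξ)
    (h : ¬ (M.shift ξ).StrictlyPassive) : M.passivityMargin ν ≤ ENNReal.ofReal (ξ / 2) := by
  rw [strictlyPassive_iff_not_obstruction] at h
  push Not at h
  obtain ⟨v, hv, hobs⟩ := h
  set y : Fin n ⊕ Fin m → ℂ := Sum.elim (v ∘ Sum.inl) (-(v ∘ Sum.inr)) with hy
  have hnorm : ‖toLp 2 y‖ = ‖toLp 2 v‖ := by simp [EuclideanSpace.norm_eq, hy]
  obtain ⟨Δ, hΔ, hsize⟩ := exists_mat_mulVec_eq (m := m) ν hv (((ξ / 2 : ℝ) : ℂ) • y)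
  have hnot : ¬ (M + Δ).StrictlyPassive := fun hpass => by
    rw [mat_shift_mulVec, ← hy, ← hΔ, ← add_mulVec, ← mat_add] at hobs
    exact hpass.not_obstruction hv hobs
  refine (iInf₂_le Δ hnot).trans (ENNReal.ofReal_le_ofReal ?_)
  rw [WithLp.toLp_smul, norm_smul, Complex.norm_real, Real.norm_of_nonneg (by positivity),
    hnorm] at hsize
  exact le_of_mul_le_mul_right hsize (norm_toLp_pos hv)

end StrictlyPassive

end StateSpace

section Unitary

lemma exists_linearIsometry_comp_eq {E V : Type*} [AddCommGroup E] [Module ℂ E]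
    [NormedAddCommGroup V] [InnerProductSpace ℂ V] [FiniteDimensional ℂ V] {f g : E →ₗ[ℂ] V}
    (h : ∀ x, ‖f x‖ = ‖g x‖) : ∃ L : V →ₗᵢ[ℂ] V, ∀ x, L (f x) = g x := by
  obtain ⟨r, hr⟩ := f.rangeRestrict.exists_rightInverse_of_surjective f.range_rangeRestrict
  have hfr (y : f.range) : f (r y) = y := congrArg Subtype.val (LinearMap.congr_fun hr y)
  let L : f.range →ₗᵢ[ℂ] V := ⟨g ∘ₗ r, fun y => by
    rw [LinearMap.comp_apply, ← h, hfr, Submodule.coe_norm]⟩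
  refine ⟨L.extend, fun x => (L.extend_apply (f.rangeRestrict x)).trans ?_⟩
  have hker : ‖g (r (f.rangeRestrict x) - x)‖ = 0 := by
    rw [← h, map_sub, hfr, LinearMap.codRestrict_apply, sub_self, norm_zero]
  rwa [norm_eq_zero, map_sub, sub_eq_zero] at hker

variable {ι κ : Type*} [Fintype ι] [Finite κ] [DecidableEq ι]

lemma exists_mem_unitaryGroup_mul_eq {P Q : Matrix ι κ ℂ} (h : Pᴴ * P = Qᴴ * Q) :
    ∃ U ∈ unitaryGroup ι ℂ, U * P = Q := by
  classical
  have := Fintype.ofFinite κ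
  have hnorm (x : κ → ℂ) : ‖toLp 2 (P *ᵥ x)‖ = ‖toLp 2 (Q *ᵥ x)‖ := by
    rw [← sq_eq_sq₀ (norm_nonneg _) (norm_nonneg _), ← reQuad_one, ← reQuad_one,
      ← reQuad_conjTranspose_mul_mul, ← reQuad_conjTranspose_mul_mul, Matrix.mul_one,
      Matrix.mul_one, h]
  obtain ⟨L, hL⟩ := exists_linearIsometry_comp_eq (f := toEuclideanLin P)
    (g := toEuclideanLin Q) fun x => hnorm x.ofLp
  let U : Matrix ι ι ℂ := (toEuclideanCLM (𝕜 := ℂ) (n := ι)).symm L.toContinuousLinearMap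
  have hU : toEuclideanCLM (𝕜 := ℂ) U = L.toContinuousLinearMap :=
    (toEuclideanCLM (𝕜 := ℂ) (n := ι)).apply_symm_apply _
  refine ⟨U, mem_unitaryGroup_iff'.2
    (EquivLike.injective (toEuclideanCLM (𝕜 := ℂ) (n := ι)) ?_), ?_⟩
  · rw [map_mul, map_star, map_one, hU]
    exact (ContinuousLinearMap.norm_map_iff_adjoint_comp_self _).1 L.norm_map
  · refine ext_of_mulVec_single fun j => ?_
    rw [← mulVec_mulVec]
    have hUL (y : EuclideanSpace ℂ ι) : U *ᵥ y.ofLp = (L y).ofLp :=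
      congrArg (fun T => (T y).ofLp) hU
    exact (hUL _).trans (congrArg WithLp.ofLp (hL (toLp 2 (Pi.single j 1))))

lemma exists_norm_eq_one_notMem {s : Set ℂ} (hs : s.Finite) : ∃ z : ℂ, ‖z‖ = 1 ∧ z ∉ s := by
  have hrank : 1 < Module.rank ℝ ℂ := by rw [Complex.rank_real_complex]; exact Nat.one_lt_ofNat
  have hinf : (Metric.sphere (0 : ℂ) 1).Infinite :=
    (isPreconnected_sphere hrank 0 1).infinite_of_nontrivial
      ⟨1, by simp, -1, by simp, by norm_num [Complex.ext_iff]⟩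
  obtain ⟨z, hz, hzs⟩ := hinf.exists_notMem_finite hs
  exact ⟨z, mem_sphere_zero_iff_norm.1 hz, hzs⟩

/- `K` is the Cayley transform `i (1 - U)⁻¹ (1 + U)`. -/
lemma exists_isHermitian_one_sub_mul_eq {U : Matrix ι ι ℂ} (hU : U ∈ unitaryGroup ι ℂ)
    (hdet : IsUnit (1 - U).det) :
    ∃ K : Matrix ι ι ℂ, K.IsHermitian ∧ (1 - U) * K = Complex.I • (1 + U) := by
  have hskew : (1 + U) * (1 - U)ᴴ = U - Uᴴ := by
    rw [conjTranspose_sub, conjTranspose_one, Matrix.mul_sub, Matrix.mul_one, Matrix.add_mul,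
      Matrix.one_mul, ← star_eq_conjTranspose, mem_unitaryGroup_iff.1 hU]
    abel
  have hHerm : (Complex.I • (U - Uᴴ)).IsHermitian := by
    rw [IsHermitian, conjTranspose_smul, conjTranspose_sub, conjTranspose_conjTranspose,
      Complex.star_def, Complex.conj_I, neg_smul, ← smul_neg, neg_sub]
  refine ⟨(1 - U)⁻¹ * (Complex.I • (U - Uᴴ)) * (1 - U)⁻¹ᴴ,
    isHermitian_mul_mul_conjTranspose _ hHerm, ?_⟩
  have hdet' : IsUnit ((1 - U)ᴴ).det := by rw [det_conjTranspose]; exact hdet.star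
  rw [← hskew, conjTranspose_nonsing_inv, ← Matrix.mul_assoc, ← Matrix.mul_assoc,
    mul_nonsing_inv _ hdet, Matrix.one_mul, Matrix.smul_mul, mul_nonsing_inv_cancel_right _ _ hdet']

lemma exists_unitary_diagonalization {U : Matrix ι ι ℂ} (hU : U ∈ unitaryGroup ι ℂ) :
    ∃ V ∈ unitaryGroup ι ℂ, ∃ μ : ι → ℂ, ∀ k, ‖μ k‖ = 1 ∧ U *ᵥ V.col k = μ k • V.col k := by
  obtain ⟨z, hz, hzU⟩ := exists_norm_eq_one_notMem U.finite_spectrum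
  have hz0 : z ≠ 0 := norm_ne_zero_iff.1 (hz.trans_ne one_ne_zero)
  have hzU' : z⁻¹ • U ∈ unitaryGroup ι ℂ := by
    rw [mem_unitaryGroup_iff, star_smul, Matrix.smul_mul, Matrix.mul_smul, smul_smul,
      mem_unitaryGroup_iff.1 hU, Complex.star_def, Complex.mul_conj', norm_inv, hz]
    simp
  have hdet : IsUnit (1 - z⁻¹ • U).det := by
    have hsplit : 1 - z⁻¹ • U = z⁻¹ • (z • 1 - U) := by
      rw [smul_sub, smul_smul, inv_mul_cancel₀ hz0, one_smul]
    rw [hsplit, det_smul]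
    exact ((inv_ne_zero hz0).isUnit.pow _).mul (isUnit_det_smul_one_sub hzU)
  obtain ⟨K, hK, hUK⟩ := exists_isHermitian_one_sub_mul_eq hzU' hdet
  have hI (a : ℝ) : (a : ℂ) + Complex.I ≠ 0 := fun h => by simpa using congrArg Complex.im h
  refine ⟨hK.eigenvectorUnitary, hK.eigenvectorUnitary.2, fun k => z *
    ((hK.eigenvalues k - Complex.I) / (hK.eigenvalues k + Complex.I)), fun k => ⟨?_, ?_⟩⟩
  · have hconj : (hK.eigenvalues k - Complex.I : ℂ) =
        (starRingEnd ℂ) (hK.eigenvalues k + Complex.I) := by simp [sub_eq_add_neg]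
    rw [norm_mul, hz, one_mul, norm_div, hconj, Complex.norm_conj,
      div_self (norm_ne_zero_iff.2 (hI _))]
  · set a := hK.eigenvalues k
    set v := (hK.eigenvectorUnitary : Matrix ι ι ℂ).col k
    have hKv : K *ᵥ v = (a : ℂ) • v := hK.mulVec_eigenvectorBasis k
    have hv : (a : ℂ) • (v - z⁻¹ • U *ᵥ v) = Complex.I • (v + z⁻¹ • U *ᵥ v) := by
      have := congrArg (· *ᵥ v) hUK
      simpa only [← mulVec_mulVec, hKv, mulVec_smul, sub_mulVec, add_mulVec, smul_mulVec,
        one_mulVec] using this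
    have hUv : (a + Complex.I) • z⁻¹ • U *ᵥ v = (a - Complex.I) • v := by
      linear_combination (norm := module) -hv
    rw [mul_smul, div_eq_inv_mul, mul_smul, ← hUv, inv_smul_smul₀ (hI a), smul_inv_smul₀ hz0]

lemma re_add_one_div_sub_one {μ : ℂ} (hμ : ‖μ‖ = 1) : ((μ + 1) / (μ - 1)).re = 0 := by
  have hsq : μ.re * μ.re + μ.im * μ.im = 1 := by
    rw [← Complex.normSq_apply, Complex.normSq_eq_norm_sq, hμ, one_pow]
  rw [Complex.div_re, ← add_div]
  simp only [Complex.add_re, Complex.sub_re, Complex.one_re, Complex.add_im, Complex.sub_im,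
    Complex.one_im]
  rw [div_eq_zero_iff]
  left
  linear_combination hsq

/- `(E + F) (E + F)ᴴ = (E - F) (E - F)ᴴ`, so `E + F = (E - F) U` with `U` unitary; diagonalize
`U`. -/
lemma exists_unitary_col_eq_smul {E F : Matrix κ ι ℂ} (h : E * Fᴴ + F * Eᴴ = 0) :
    ∃ V ∈ unitaryGroup ι ℂ, ∀ k, F *ᵥ V.col k = 0 ∨
      ∃ ω : ℝ, E *ᵥ V.col k = (Complex.I * ω) • F *ᵥ V.col k := by
  have := Fintype.ofFinite κ
  obtain ⟨U, hU, hUEF⟩ := exists_mem_unitaryGroup_mul_eq (P := (E - F)ᴴ) (Q := (E + F)ᴴ) (by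
    simp only [conjTranspose_conjTranspose, conjTranspose_add, conjTranspose_sub, Matrix.add_mul,
      Matrix.mul_add, Matrix.sub_mul, Matrix.mul_sub]
    rw [add_eq_zero_iff_eq_neg] at h
    rw [h]
    abel)
  obtain ⟨V, hV, μ, hμ⟩ := exists_unitary_diagonalization (Unitary.star_mem hU)
  refine ⟨V, hV, fun k => ?_⟩
  obtain ⟨hnorm, heig⟩ := hμ k
  set e := E *ᵥ V.col k
  set f := F *ᵥ V.col k
  have hEF : (E - F) * star U = E + F := by
    rw [star_eq_conjTranspose, ← conjTranspose_conjTranspose (E - F), ← conjTranspose_mul, hUEF,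
      conjTranspose_conjTranspose]
  have hcol : (E + F) *ᵥ V.col k = μ k • (E - F) *ᵥ V.col k := by
    rw [← hEF, ← mulVec_mulVec, heig, mulVec_smul]
  have hef : (μ k - 1) • e = (μ k + 1) • f := by
    rw [add_mulVec, sub_mulVec] at hcol
    linear_combination (norm := module) -hcol
  by_cases hone : μ k = 1
  · rw [hone, sub_self, zero_smul, eq_comm, smul_eq_zero] at hef
    exact .inl (hef.resolve_left (by norm_num))
  · refine .inr ⟨((μ k + 1) / (μ k - 1)).im, ?_⟩
    have hI : Complex.I * ((μ k + 1) / (μ k - 1)).im = (μ k + 1) / (μ k - 1) := by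
      apply Complex.ext <;> simp [re_add_one_div_sub_one hnorm]
    rw [hI, div_eq_inv_mul, mul_smul, ← hef, inv_smul_smul₀ (sub_ne_zero.2 hone)]

end Unitary

section Separation

lemma exists_forall_neg_and_forall_nonneg {E : Type*} [TopologicalSpace E] [AddCommGroup E]
    [IsTopologicalAddGroup E] [Module ℝ E] [ContinuousSMul ℝ E] {s t : Set E} (hs : Convex ℝ s)
    (hso : IsOpen s) (hsmul : ∀ r : ℝ, 0 < r → ∀ x ∈ s, r • x ∈ s) (hsne : s.Nonempty)
    (ht : Convex ℝ t) (htne : t.Nonempty) (hdisj : Disjoint s t) :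
    ∃ f : StrongDual ℝ E, (∀ x ∈ s, f x < 0) ∧ ∀ y ∈ t, 0 ≤ f y := by
  obtain ⟨f, u, hfs, hft⟩ := geometric_hahn_banach_open hs hso ht hdisj
  have hscale (x : E) (hx : x ∈ s) (r : ℝ) (hr : 0 < r) : r * f x < u := by
    simpa using hfs _ (hsmul r hr x hx)
  have hle (x : E) (hx : x ∈ s) : f x ≤ 0 := by
    by_contra! hpos
    have := hscale x hx ((|u| + 1) / f x) (by positivity)
    rw [div_mul_cancel₀ _ hpos.ne'] at this
    linarith [le_abs_self u]
  have hu : 0 ≤ u := by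
    obtain ⟨x, hx⟩ := hsne
    have hlim : Tendsto (fun r : ℝ => r * f x) (𝓝[>] 0) (𝓝 0) := by
      simpa using ((continuous_mul_const (f x)).tendsto 0).mono_left nhdsWithin_le_nhds
    exact le_of_tendsto hlim (eventually_mem_nhdsWithin.mono fun r hr => (hscale x hx r hr).le)
  have hf : f ≠ 0 := by
    rintro rfl
    obtain ⟨⟨x, hx⟩, y, hy⟩ := And.intro hsne htne
    exact ((hfs x hx).trans_le (hft y hy)).ne rfl
  refine ⟨f, fun x hx => ?_, fun y hy => hu.trans (hft y hy)⟩
  have hsub : f '' s ⊆ interior (Set.Iic 0) :=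
    interior_maximal (Set.image_subset_iff.2 hle) (f.isOpenMap_of_ne_zero hf _ hso)
  rw [interior_Iic] at hsub
  exact hsub ⟨x, hx, rfl⟩

lemma exists_trace_mul_eq {ι κ R : Type*} [Fintype ι] [Fintype κ] [CommSemiring R]
    (f : Matrix ι κ R →ₗ[R] R) : ∃ Y : Matrix κ ι R, ∀ N, (Y * N).trace = f N := by
  classical
  refine ⟨of fun j i => f (single i j 1), fun N => LinearMap.congr_fun (f := traceLinearMap κ R R ∘ₗ
    mulLeftLinearMap κ R (of fun j i => f (single i j 1))) (ext_linearMap R fun i j => ?_) N⟩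
  ext
  simp [trace_mul_single]

variable {ι κ : Type*} [Fintype ι] [Fintype κ]

lemma re_trace_conjTranspose_mul {N : Matrix ι ι ℂ} (hN : N.IsHermitian) (Z : Matrix ι ι ℂ) :
    (Zᴴ * N).trace.re = (Z * N).trace.re := by
  have h : (Zᴴ * N).trace = star (Z * N).trace := by
    rw [← trace_conjTranspose, conjTranspose_mul, hN.eq, trace_mul_comm]
  rw [h, Complex.star_def, Complex.conj_re]

lemma re_trace_mul_vecMulVec (Z : Matrix ι ι ℂ) (v : ι → ℂ) :
    (Z * vecMulVec v (star v)).trace.re = reQuad Z v := by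
  rw [mul_vecMulVec, trace_vecMulVec, dotProduct_comm, reQuad]

lemma exists_isHermitian_re_trace_mul_eq (f : Module.Dual ℝ (Matrix ι ι ℂ)) :
    ∃ Z : Matrix ι ι ℂ, Z.IsHermitian ∧
      ∀ N : Matrix ι ι ℂ, N.IsHermitian → (Z * N).trace.re = f N := by
  obtain ⟨Y, hY⟩ := exists_trace_mul_eq (f.extendRCLike (𝕜 := ℂ))
  refine ⟨(1 / 2 : ℝ) • (Yᴴ + Y), (isHermitian_transpose_add_self Y).smul (.all _),
    fun N hN => ?_⟩
  have hre : (Y * N).trace.re = f N := by rw [hY]; exact f.re_extendRCLike_apply (𝕜 := ℂ) N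
  rw [Matrix.smul_mul, trace_smul, Complex.smul_re, Matrix.add_mul, trace_add, Complex.add_re,
    re_trace_conjTranspose_mul hN, hre, smul_eq_mul]
  ring

lemma convex_setOf_reQuad_pos : Convex ℝ {H : Matrix ι ι ℂ | ∀ v, v ≠ 0 → 0 < reQuad H v} := by
  refine convex_iff_forall_pos.2 fun H hH K hK a b ha hb _ v hv => ?_
  rw [reQuad_add, reQuad_smul, reQuad_smul]
  exact add_pos (mul_pos ha (hH v hv)) (mul_pos hb (hK v hv))

theorem exists_posSemidef_of_forall_not_posDef {t : Set (Matrix ι ι ℂ)} (ht : Convex ℝ t)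
    (hne : t.Nonempty) (hherm : ∀ H ∈ t, H.IsHermitian) (hnot : ∀ H ∈ t, ¬ H.PosDef) :
    ∃ Z : Matrix ι ι ℂ, Z.PosSemidef ∧ Z ≠ 0 ∧ ∀ H ∈ t, (Z * H).trace.re ≤ 0 := by
  classical
  obtain ⟨f, hneg, hnonneg⟩ := exists_forall_neg_and_forall_nonneg convex_setOf_reQuad_pos
    isOpen_setOf_reQuad_pos (fun r hr H hH v hv => by
      rw [reQuad_smul]; exact mul_pos hr (hH v hv))
    ⟨1, fun _ => reQuad_pos .one⟩ ht hne (Set.disjoint_left.2 fun H hpos hH =>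
      hnot H hH ((posDef_iff_reQuad (hherm H hH)).2 hpos))
  obtain ⟨Z, hZ, hZf⟩ := exists_isHermitian_re_trace_mul_eq (-f.toLinearMap)
  replace hZf (N : Matrix ι ι ℂ) (hN : N.IsHermitian) : (Z * N).trace.re = -f N := hZf N hN
  refine ⟨Z, (posSemidef_iff_reQuad hZ).2 fun v => ?_, fun h0 => ?_, fun H hH => ?_⟩
  · have hvv := posSemidef_vecMulVec_self_star v
    rw [← re_trace_mul_vecMulVec, hZf _ hvv.1, neg_nonneg]
    have hlim : Tendsto (fun ε : ℝ => f (vecMulVec v (star v) + ε • 1)) (𝓝[>] 0)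
        (𝓝 (f (vecMulVec v (star v)))) := by
      have hcont : Continuous fun ε : ℝ => f (vecMulVec v (star v) + ε • 1) := by fun_prop
      simpa using (hcont.tendsto 0).mono_left nhdsWithin_le_nhds
    refine le_of_tendsto hlim (eventually_mem_nhdsWithin.mono fun ε hε => (hneg _ ?_).le)
    exact fun w => reQuad_pos (PosDef.posSemidef_add hvv (PosDef.one.smul hε))
  · have h1 := hZf 1 isHermitian_one
    rw [h0, Matrix.zero_mul, trace_zero, Complex.zero_re] at h1
    linarith [hneg 1 fun _ => reQuad_pos .one]
  · rw [hZf H (hherm H hH), neg_nonpos]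
    exact hnonneg H hH

open scoped MatrixOrder in
lemma exists_eq_mul_conjTranspose_of_posSemidef {Z : Matrix ι ι ℂ} (hZ : Z.PosSemidef) :
    ∃ L : Matrix ι ι ℂ, Z = L * Lᴴ := by
  classical
  obtain ⟨B, hB⟩ := CStarAlgebra.nonneg_iff_eq_star_mul_self.1 hZ.nonneg
  exact ⟨Bᴴ, by rw [conjTranspose_conjTranspose, hB, star_eq_conjTranspose]⟩

lemma sum_reQuad_col [DecidableEq ι] (H : Matrix ι ι ℂ) {V : Matrix ι ι ℂ}
    (hV : V ∈ unitaryGroup ι ℂ) : ∑ k, reQuad H (V.col k) = H.trace.re := by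
  have htrace : H.trace = (Vᴴ * H * V).trace := by
    rw [trace_mul_comm, ← Matrix.mul_assoc, ← star_eq_conjTranspose, mem_unitaryGroup_iff.1 hV,
      Matrix.one_mul]
  rw [htrace, Matrix.mul_assoc, trace, Complex.re_sum]
  rfl

lemma add_conjTranspose_eq_zero_of_le_re_trace {G : Matrix ι ι ℂ} {c : ℝ}
    (h : ∀ X : Matrix ι ι ℂ, X.IsHermitian → c ≤ (X * G).trace.re) : G + Gᴴ = 0 := by
  set H := G + Gᴴ with hH
  have hherm : H.IsHermitian := isHermitian_add_transpose_self G
  have hHG : (H * G).trace.re = 0 := by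
    by_contra hne
    have := h (((c - 1) / (H * G).trace.re) • H) (hherm.smul (.all _))
    rw [Matrix.smul_mul, trace_smul, Complex.smul_re, smul_eq_mul, div_mul_cancel₀ _ hne] at this
    linarith
  have hre : (Hᴴ * H).trace.re = 0 := by
    nth_rw 2 [hH]
    rw [hherm.eq, Matrix.mul_add, trace_add, Complex.add_re, trace_mul_comm H Gᴴ,
      re_trace_conjTranspose_mul hherm, trace_mul_comm G H, hHG, add_zero]
  have him := (Complex.le_def.1 (posSemidef_conjTranspose_mul_self H).trace_nonneg).2
  exact trace_conjTranspose_mul_self_eq_zero_iff.1 (Complex.ext hre him.symm)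

end Separation

section Lyapunov

lemma tendsto_pow_zero_of_spectrum_norm_lt_one {R : Type*} [NormedRing R] [NormedAlgebra ℂ R]
    [CompleteSpace R] {a : R} (ha : ∀ μ ∈ spectrum ℂ a, ‖μ‖ < 1) :
    Tendsto (fun j : ℕ => a ^ j) atTop (𝓝 0) := by
  nontriviality R
  have hradius : spectralRadius ℂ a < (1 : NNReal) :=
    spectrum.spectralRadius_lt_of_forall_lt a fun μ hμ => ha μ hμ
  obtain ⟨r, har, hr⟩ := ENNReal.lt_iff_exists_nnreal_btwn.1 hradius
  have hroot := (spectrum.pow_nnnorm_pow_one_div_tendsto_nhds_spectralRadius a).eventually_lt_const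
    har
  refine squeeze_zero_norm' ?_
    (tendsto_pow_atTop_nhds_zero_of_lt_one r.2 (by exact_mod_cast hr : (r : ℝ) < 1))
  filter_upwards [hroot, eventually_gt_atTop 0] with j hj hj0
  have hj0' : (0 : ℝ) < j := Nat.cast_pos.2 hj0
  have hpow := ENNReal.rpow_lt_rpow hj hj0'
  rw [← ENNReal.rpow_mul, one_div, inv_mul_cancel₀ hj0'.ne', ENNReal.rpow_one,
    ENNReal.rpow_natCast, ← ENNReal.coe_pow, ENNReal.coe_lt_coe] at hpow
  exact_mod_cast hpow.le

variable {ι : Type*} [Fintype ι] [DecidableEq ι]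

open scoped Matrix.Norms.Operator in
lemma tendsto_pow_mulVec_of_spectrum_norm_lt_one {S : Matrix ι ι ℂ}
    (hS : ∀ μ ∈ spectrum ℂ S, ‖μ‖ < 1) (w : ι → ℂ) :
    Tendsto (fun j : ℕ => S ^ j *ᵥ w) atTop (𝓝 0) := by
  have : CompleteSpace (Matrix ι ι ℂ) := FiniteDimensional.complete ℂ _
  have hnorm := ((tendsto_pow_zero_of_spectrum_norm_lt_one hS).norm.mul_const ‖w‖)
  rw [norm_zero, zero_mul] at hnorm
  exact squeeze_zero_norm (fun j => linfty_opNorm_mulVec _ _) hnorm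

theorem posDef_of_posDef_sub_conjTranspose_mul_mul {S X : Matrix ι ι ℂ}
    (hS : ∀ μ ∈ spectrum ℂ S, ‖μ‖ < 1) (hX : X.IsHermitian) (hdec : (X - Sᴴ * X * S).PosDef) :
    X.PosDef := by
  have hlt (w : ι → ℂ) (hw : w ≠ 0) : reQuad X (S *ᵥ w) < reQuad X w := by
    have := reQuad_pos hdec hw
    rwa [reQuad_sub, reQuad_conjTranspose_mul_mul, sub_pos] at this
  have hle (w : ι → ℂ) : reQuad X (S *ᵥ w) ≤ reQuad X w := by
    have := reQuad_nonneg hdec.posSemidef w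
    rwa [reQuad_sub, reQuad_conjTranspose_mul_mul, sub_nonneg] at this
  have hnonneg (w : ι → ℂ) : 0 ≤ reQuad X w := by
    have hlim : Tendsto (fun j : ℕ => reQuad X (S ^ j *ᵥ w)) atTop (𝓝 0) := by
      have hcont : Continuous fun v => reQuad X v :=
        continuous_reQuad.comp (Continuous.prodMk_right X)
      simpa [Function.comp_def, reQuad] using (hcont.tendsto 0).comp
        (tendsto_pow_mulVec_of_spectrum_norm_lt_one hS w)
    have hanti : Antitone fun j : ℕ => reQuad X (S ^ j *ᵥ w) :=
      antitone_nat_of_succ_le fun j => by rw [pow_succ', ← mulVec_mulVec]; exact hle _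
    simpa using hanti.le_of_tendsto hlim 0
  exact (posDef_iff_reQuad hX).2 fun w hw => (hnonneg _).trans_lt (hlt w hw)

lemma norm_lt_one_of_re_sub_one_div_add_one_neg {μ : ℂ} (hμ : ((μ - 1) / (μ + 1)).re < 0) :
    ‖μ‖ < 1 := by
  rw [Complex.div_re, ← add_div] at hμ
  have hnum := neg_of_div_neg_left hμ (Complex.normSq_nonneg _)
  simp only [Complex.add_re, Complex.sub_re, Complex.one_re, Complex.add_im, Complex.sub_im,
    Complex.one_im] at hnum
  rw [← sq_lt_one_iff₀ (norm_nonneg μ), ← Complex.normSq_eq_norm_sq, Complex.normSq_apply]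
  linarith

lemma norm_lt_one_of_mem_spectrum_cayley {A : Matrix ι ι ℂ} (hA : ∀ z ∈ spectrum ℂ A, z.re < 0)
    (hdet : IsUnit (1 - A).det) {μ : ℂ} (hμ : μ ∈ spectrum ℂ ((1 + A) * (1 - A)⁻¹)) : ‖μ‖ < 1 := by
  obtain ⟨w, hw0, hw⟩ := mem_spectrum_iff_exists_mulVec.1 hμ
  obtain ⟨y, rfl⟩ : ∃ y, w = (1 - A) *ᵥ y :=
    ⟨(1 - A)⁻¹ *ᵥ w, by rw [mulVec_mulVec, mul_nonsing_inv _ hdet, one_mulVec]⟩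
  have hy0 : y ≠ 0 := by
    rintro rfl
    exact hw0 (mulVec_zero _)
  rw [mulVec_mulVec, nonsing_inv_mul_cancel_right _ _ hdet, add_mulVec, sub_mulVec,
    one_mulVec] at hw
  have hAy : (μ + 1) • A *ᵥ y = (μ - 1) • y := by
    linear_combination (norm := module) hw
  have hne : μ + 1 ≠ 0 := by
    intro h0
    rw [h0, zero_smul, eq_neg_of_add_eq_zero_left h0, eq_comm, smul_eq_zero] at hAy
    exact hAy.elim (by norm_num) hy0
  refine norm_lt_one_of_re_sub_one_div_add_one_neg
    (hA _ (mem_spectrum_iff_exists_mulVec.2 ⟨y, hy0, ?_⟩))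
  rw [div_eq_inv_mul, mul_smul, ← hAy, inv_smul_smul₀ hne]

theorem posDef_of_lyapunov {A X : Matrix ι ι ℂ} (hA : ∀ z ∈ spectrum ℂ A, z.re < 0)
    (hX : X.IsHermitian) (hAX : (-(Aᴴ * X) - X * A).PosDef) : X.PosDef := by
  have hdet : IsUnit (1 - A).det := by
    simpa using isUnit_det_smul_one_sub (A := A) (s := 1) fun h => absurd (hA 1 h) (by simp)
  refine posDef_of_posDef_sub_conjTranspose_mul_mul
    (fun μ => norm_lt_one_of_mem_spectrum_cayley hA hdet) hX ?_
  have hcayley : X - ((1 + A) * (1 - A)⁻¹)ᴴ * X * ((1 + A) * (1 - A)⁻¹) =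
      ((1 - A)⁻¹)ᴴ * ((2 : ℝ) • (-(Aᴴ * X) - X * A)) * (1 - A)⁻¹ := by
    have hfactor : X = ((1 - A)⁻¹)ᴴ * ((1 - A)ᴴ * X * (1 - A)) * (1 - A)⁻¹ := by
      simp only [← Matrix.mul_assoc]
      rw [← conjTranspose_mul, mul_nonsing_inv _ hdet, conjTranspose_one, Matrix.one_mul,
        mul_nonsing_inv_cancel_right _ _ hdet]
    nth_rw 1 [hfactor]
    have hexpand : (2 : ℝ) • (-(Aᴴ * X) - X * A) =
        (1 - A)ᴴ * X * (1 - A) - (1 + A)ᴴ * X * (1 + A) := by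
      simp only [conjTranspose_sub, conjTranspose_add, conjTranspose_one, Matrix.sub_mul,
        Matrix.add_mul, Matrix.mul_sub, Matrix.mul_add, Matrix.one_mul, Matrix.mul_one]
      module
    rw [hexpand, conjTranspose_mul]
    simp only [Matrix.mul_sub, Matrix.sub_mul, Matrix.mul_assoc]
  rw [hcayley]
  exact (hAX.smul two_pos).conjTranspose_mul_mul_same
    (mulVec_injective_of_isUnit ((isUnit_nonsing_inv_iff).2 ((isUnit_iff_isUnit_det _).2 hdet)))

end Lyapunov

lemma sum_star_col_dotProduct_col {ι κ : Type*} [Fintype ι] [Fintype κ] (P Q : Matrix ι κ ℂ) :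
    ∑ k, star (P.col k) ⬝ᵥ Q.col k = (Q * Pᴴ).trace := by
  rw [trace_mul_comm]
  rfl

namespace StateSpace

variable {n m : ℕ} {M : StateSpace n m}

lemma W_smul_add (M : StateSpace n m) (X Y : Matrix (Fin n) (Fin n) ℂ) (c : ℝ) :
    M.W (c • Y + X) = c • (M.W Y - M.W 0) + M.W X := by
  rw [W, W, W, W, sub_eq_add_neg (fromBlocks _ _ _ _), fromBlocks_neg, fromBlocks_add,
    fromBlocks_smul, fromBlocks_add]
  simp only [Matrix.mul_add, Matrix.add_mul, Matrix.mul_smul, Matrix.smul_mul, Matrix.mul_zero,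
    Matrix.zero_mul]
  congr 1 <;> module

lemma W_convexCombination (M : StateSpace n m) (X Y : Matrix (Fin n) (Fin n) ℂ) {a b : ℝ}
    (hab : a + b = 1) : M.W (a • X + b • Y) = a • M.W X + b • M.W Y := by
  obtain rfl : b = 1 - a := eq_sub_of_add_eq' hab
  rw [W_smul_add, ← add_zero ((1 - a) • Y), W_smul_add]
  module

lemma re_trace_conjTranspose_mul_W_mul (M : StateSpace n m) {X : Matrix (Fin n) (Fin n) ℂ}
    (hX : X.IsHermitian) {κ : Type*} [Fintype κ] (L : Matrix (Fin n ⊕ Fin m) κ ℂ) :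
    (Lᴴ * M.W X * L).trace.re =
      (Lᴴ * M.W 0 * L).trace.re - 2 * (X * ((M.mat * L).toRows₁ * L.toRows₁ᴴ)).trace.re := by
  classical
  have htrace : (X * ((M.mat * L).toRows₁ * L.toRows₁ᴴ)).trace.re =
      ∑ k, (star (L.col k ∘ Sum.inl) ⬝ᵥ X *ᵥ ((M.mat *ᵥ L.col k) ∘ Sum.inl)).re := by
    rw [← Matrix.mul_assoc, ← sum_star_col_dotProduct_col, Complex.re_sum]
    rfl
  have hcol (k : κ) : L *ᵥ (1 : Matrix κ κ ℂ).col k = L.col k := by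
    rw [← mulVec_single_one, one_mulVec, mulVec_single_one]
  rw [← sum_reQuad_col _ (one_mem (unitaryGroup κ ℂ)), ← sum_reQuad_col _ (one_mem _), htrace,
    Finset.mul_sum, ← Finset.sum_sub_distrib]
  refine Finset.sum_congr rfl fun k _ => ?_
  rw [reQuad_conjTranspose_mul_mul, reQuad_conjTranspose_mul_mul, hcol,
    reQuad_W_eq_inr_sub_inl M hX, reQuad_W_eq_inr_sub_inl M isHermitian_zero, zero_mulVec,
    dotProduct_zero, Complex.zero_re, sub_zero, mul_sub]

/- Each column of `L * V`, for the unitary `V` of `exists_unitary_col_eq_smul`, is a frequency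
response of `M`, so its contribution to the trace of `(L * V)ᴴ * W * (L * V)` is positive unless it
vanishes. -/
lemma StrictlyPassive.eq_zero_of_re_trace_le (h : M.StrictlyPassive) {κ : Type*} [Fintype κ]
    {L : Matrix (Fin n ⊕ Fin m) κ ℂ}
    (hL : ∀ X : Matrix (Fin n) (Fin n) ℂ, X.IsHermitian → (Lᴴ * M.W X * L).trace.re ≤ 0) :
    L = 0 := by
  classical
  have hskew := add_conjTranspose_eq_zero_of_le_re_trace (G := (M.mat * L).toRows₁ * L.toRows₁ᴴ)
    (c := (Lᴴ * M.W 0 * L).trace.re / 2) fun X hX => by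
      linarith [hL X hX, re_trace_conjTranspose_mul_W_mul M hX L]
  rw [conjTranspose_mul, conjTranspose_conjTranspose] at hskew
  obtain ⟨V, hV, hcol⟩ := exists_unitary_col_eq_smul hskew
  have hpos (k : κ) (hk : L *ᵥ V.col k ≠ 0) : 0 < reQuad (M.W 0) (L *ᵥ V.col k) := by
    by_contra! hle
    rw [reQuad_W_eq_inr_sub_inl M isHermitian_zero, zero_mulVec, dotProduct_zero, Complex.zero_re,
      sub_zero] at hle
    refine h.not_obstruction hk (.inr ?_)
    rcases hcol k with h0 | ⟨ω, hω⟩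
    · exact .inr ⟨h0, by linarith⟩
    · refine .inl ⟨ω, ?_, by linarith⟩
      rw [mulVec_mulVec]
      exact hω
  have hnonneg (k : κ) : 0 ≤ reQuad (M.W 0) (L *ᵥ V.col k) := by
    by_cases hk : L *ᵥ V.col k = 0
    · rw [hk, reQuad, mulVec_zero, dotProduct_zero, Complex.zero_re]
    · exact (hpos k hk).le
  have hsum : ∑ k, reQuad (M.W 0) (L *ᵥ V.col k) ≤ 0 := by
    simp only [← reQuad_conjTranspose_mul_mul, sum_reQuad_col _ hV]
    exact hL 0 isHermitian_zero
  have hzero (k : κ) : L *ᵥ V.col k = 0 := by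
    by_contra hk
    have := Finset.single_le_sum (fun i _ => hnonneg i) (Finset.mem_univ k)
    linarith [hpos k hk]
  have hLV : L * V = 0 := by
    ext i k
    exact congrFun (hzero k) i
  rw [← Matrix.mul_one L, ← mem_unitaryGroup_iff.1 hV, ← Matrix.mul_assoc, hLV, Matrix.zero_mul]

/- The strict Kalman-Yakubovich-Popov lemma. If no Hermitian `X` works, a hyperplane separates the
affine space of all `M.W X` from the positive definite cone; its normal `L * Lᴴ` contradicts strict
passivity. -/
theorem StrictlyPassive.exists_posDef_W (h : M.StrictlyPassive) :
    ∃ X : Matrix (Fin n) (Fin n) ℂ, X.PosDef ∧ (M.W X).PosDef := by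
  suffices hW : ∃ X : Matrix (Fin n) (Fin n) ℂ, X.IsHermitian ∧ (M.W X).PosDef by
    obtain ⟨X, hX, hW⟩ := hW
    have hlyapunov : (-(M.Aᴴ * X) - X * M.A).PosDef := hW.submatrix Sum.inl_injective
    exact ⟨X, posDef_of_lyapunov h.1 hX hlyapunov, hW⟩
  by_contra! hnot
  have hconvex : Convex ℝ (M.W '' {X | X.IsHermitian}) := by
    rintro _ ⟨X, hX, rfl⟩ _ ⟨Y, hY, rfl⟩ a b - - hab
    exact ⟨a • X + b • Y, (IsHermitian.smul hX (.all a)).add (IsHermitian.smul hY (.all b)),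
      W_convexCombination M X Y hab⟩
  obtain ⟨Z, hZ, hZ0, hle⟩ := exists_posSemidef_of_forall_not_posDef hconvex
    ⟨_, 0, isHermitian_zero, rfl⟩ (by rintro _ ⟨X, hX, rfl⟩; exact M.isHermitian_W hX)
    (by rintro _ ⟨X, hX, rfl⟩; exact hnot X hX)
  obtain ⟨L, rfl⟩ := exists_eq_mul_conjTranspose_of_posSemidef hZ
  refine hZ0 ?_
  rw [h.eq_zero_of_re_trace_le (L := L) fun X hX => ?_, Matrix.zero_mul]
  rw [trace_mul_comm, ← Matrix.mul_assoc]
  exact hle _ ⟨X, hX, rfl⟩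

end StateSpace

section Controllable

namespace StateSpace

variable {n m : ℕ} {A : Matrix (Fin n) (Fin n) ℂ}

lemma Controllable.exists_mul_add_mul_eq_one {B : Matrix (Fin n) (Fin m) ℂ} (h : Controllable A B)
    (s : ℂ) : ∃ (P : Matrix (Fin n) (Fin n) ℂ) (Q : Matrix (Fin m) (Fin n) ℂ),
      (s • (1 : Matrix (Fin n) (Fin n) ℂ) - A) * P + B * Q = 1 := by
  have hrange :
      LinearMap.range (fromCols (s • (1 : Matrix (Fin n) (Fin n) ℂ) - A) B).mulVecLin = ⊤ :=
    Submodule.eq_top_of_finrank_eq ((h s).trans (Module.finrank_fin_fun ℂ).symm)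
  obtain ⟨R, hR⟩ := mulVec_surjective_iff_exists_right_inverse.1 (LinearMap.range_eq_top.1 hrange)
  refine ⟨R.toRows₁, R.toRows₂, ?_⟩
  rw [← fromCols_mul_fromRows, fromRows_toRows, hR]

lemma Controllable.eq_zero_of_mulVec_eq_smul {C : Matrix (Fin m) (Fin n) ℂ}
    (h : Controllable Aᴴ Cᴴ) {s : ℂ} {q : Fin n → ℂ} (hA : A *ᵥ q = s • q) (hC : C *ᵥ q = 0) :
    q = 0 := by
  obtain ⟨P, Q, hPQ⟩ := h.exists_mul_add_mul_eq_one (star s)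
  have hleft : Pᴴ * (s • (1 : Matrix (Fin n) (Fin n) ℂ) - A) + Qᴴ * C = 1 := by
    simpa using congrArg conjTranspose hPQ
  rw [← one_mulVec q, ← hleft, add_mulVec, ← mulVec_mulVec, ← mulVec_mulVec, sub_mulVec,
    smul_mulVec, one_mulVec, hA, hC, sub_self, mulVec_zero, mulVec_zero, add_zero]

lemma Controllable.eq_bot {C : Matrix (Fin m) (Fin n) ℂ} (h : Controllable Aᴴ Cᴴ)
    {K : Submodule ℂ (Fin n → ℂ)} (hA : ∀ x ∈ K, A *ᵥ x ∈ K) (hC : ∀ x ∈ K, C *ᵥ x = 0) :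
    K = ⊥ := by
  by_contra hK
  have : Nontrivial K := Submodule.nontrivial_iff_ne_bot.2 hK
  obtain ⟨s, hs⟩ := Module.End.exists_eigenvalue (A.mulVecLin.restrict hA)
  obtain ⟨q, hq⟩ := hs.exists_hasEigenvector
  exact hq.2 (Subtype.ext
    (h.eq_zero_of_mulVec_eq_smul (congrArg Subtype.val hq.apply_eq_smul) (hC q q.2)))

lemma Controllable.eq_top {B : Matrix (Fin n) (Fin m) ℂ} (h : Controllable A B)
    {K : Submodule ℂ (Fin n → ℂ)} (hA : ∀ x ∈ K, A *ᵥ x ∈ K) (hB : ∀ u, B *ᵥ u ∈ K) : K = ⊤ := by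
  by_contra hK
  have : Nontrivial ((Fin n → ℂ) ⧸ K) := Submodule.Quotient.nontrivial_iff.2 hK
  set f : Module.End ℂ ((Fin n → ℂ) ⧸ K) := K.mapQ K A.mulVecLin hA
  obtain ⟨s, hs⟩ := Module.End.exists_eigenvalue f
  obtain ⟨P, Q, hPQ⟩ := h.exists_mul_add_mul_eq_one s
  have hsurj : Function.Surjective (f - algebraMap ℂ (Module.End ℂ ((Fin n → ℂ) ⧸ K)) s) := by
    intro y
    obtain ⟨x, rfl⟩ := Submodule.Quotient.mk_surjective K y
    refine ⟨Submodule.Quotient.mk (-(P *ᵥ x)), (Submodule.Quotient.eq K).2 ?_⟩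
    have hx : A *ᵥ (-(P *ᵥ x)) - s • (-(P *ᵥ x)) - x = -(B *ᵥ (Q *ᵥ x)) := by
      conv_lhs => enter [2]; rw [← one_mulVec x, ← hPQ, add_mulVec, ← mulVec_mulVec,
        ← mulVec_mulVec, sub_mulVec, smul_mulVec, one_mulVec]
      rw [mulVec_neg]
      module
    exact hx ▸ K.neg_mem (hB _)
  have hinj := LinearMap.injective_iff_surjective.2 hsurj
  rw [Module.End.hasEigenvalue_iff, Module.End.eigenspace_def] at hs
  exact hs (LinearMap.ker_eq_bot.2 hinj)

end StateSpace

end Controllable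

lemma posSemidef_of_forall_smul_add_posSemidef {ι : Type*} [Finite ι] {P Q : Matrix ι ι ℂ}
    (h : ∀ c : ℝ, 0 ≤ c → (c • Q + P).PosSemidef) : Q.PosSemidef := by
  have := Fintype.ofFinite ι
  have hQ : Q.IsHermitian := by
    simpa using (h 1 zero_le_one).1.sub (h 0 le_rfl).1
  refine (posSemidef_iff_reQuad hQ).2 fun v => ?_
  by_contra! hneg
  have hpos : 0 ≤ reQuad P v := by simpa using reQuad_nonneg (h 0 le_rfl) v
  have := reQuad_nonneg (h ((reQuad P v + 1) / -reQuad Q v)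
    (div_nonneg (by linarith) (by linarith))) v
  rw [reQuad_add, reQuad_smul, div_neg, neg_mul, div_mul_cancel₀ _ hneg.ne] at this
  linarith

namespace StateSpace

variable {n m : ℕ} {M : StateSpace n m} {X Y : Matrix (Fin n) (Fin n) ℂ}

lemma W_mulVec_of_mulVec_eq_zero (M : StateSpace n m) {v : Fin n ⊕ Fin m → ℂ}
    (hv : X *ᵥ (v ∘ Sum.inl) = 0) :
    M.W X *ᵥ v = Sum.elim (M.Cᴴ *ᵥ (v ∘ Sum.inr) - X *ᵥ ((M.mat *ᵥ v) ∘ Sum.inl))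
      ((M.mat *ᵥ v) ∘ Sum.inr + M.Dᴴ *ᵥ (v ∘ Sum.inr)) := by
  rw [W, fromBlocks_mulVec, mat_mulVec_inl, mat_mulVec_inr]
  simp only [sub_mulVec, add_mulVec, neg_mulVec, ← mulVec_mulVec, hv, mulVec_zero, mulVec_add]
  congr 1 <;> abel

lemma reQuad_W_of_mulVec_eq_zero (M : StateSpace n m) (hX : X.IsHermitian)
    {v : Fin n ⊕ Fin m → ℂ} (hv : X *ᵥ (v ∘ Sum.inl) = 0) :
    reQuad (M.W X) v = 2 * (star (v ∘ Sum.inr) ⬝ᵥ (M.mat *ᵥ v) ∘ Sum.inr).re := by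
  rw [reQuad_W_eq_inr_sub_inl M hX, dotProduct_mulVec, ← hX.eq, ← star_mulVec, hv, star_zero,
    zero_dotProduct, Complex.zero_re, sub_zero]

theorem posDef_of_posSemidef_W (hM : Controllable M.Aᴴ M.Cᴴ) (hX : X.PosSemidef)
    (hW : (M.W X).PosSemidef) : X.PosDef := by
  have hker (q : Fin n → ℂ) (hq : X *ᵥ q = 0) : X *ᵥ (M.A *ᵥ q) = 0 ∧ M.C *ᵥ q = 0 := by
    have hv : X *ᵥ (Sum.elim q (0 : Fin m → ℂ) ∘ Sum.inl) = 0 := hq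
    have hzero := mulVec_eq_zero_of_reQuad_eq_zero hW (by
      rw [reQuad_W_of_mulVec_eq_zero M hX.1 hv, Sum.elim_comp_inr, star_zero, zero_dotProduct,
        Complex.zero_re, mul_zero])
    rw [W_mulVec_of_mulVec_eq_zero M hv, mat_mulVec_inl, mat_mulVec_inr, Sum.elim_comp_inl,
      Sum.elim_comp_inr] at hzero
    exact ⟨by simpa using congrArg (· ∘ Sum.inl) hzero, by simpa using congrArg (· ∘ Sum.inr) hzero⟩
  have hbot := hM.eq_bot (K := LinearMap.ker X.mulVecLin) (fun q hq => (hker q hq).1)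
    fun q hq => (hker q hq).2
  refine (PosSemidef.posDef_iff_isUnit hX).2 (mulVec_injective_iff_isUnit.1 ?_)
  exact LinearMap.ker_eq_bot.1 hbot

lemma eq_zero_of_posSemidef_W_sub (hM : Controllable M.A M.B) (hY : Y.IsHermitian)
    (hW : (M.W Y - M.W 0).PosSemidef) : Y = 0 := by
  have hker (v : Fin n ⊕ Fin m → ℂ) (hv : Y *ᵥ (v ∘ Sum.inl) = 0) :
      Y *ᵥ (M.A *ᵥ (v ∘ Sum.inl) + M.B *ᵥ (v ∘ Sum.inr)) = 0 := by
    have hv0 : (0 : Matrix (Fin n) (Fin n) ℂ) *ᵥ (v ∘ Sum.inl) = 0 := zero_mulVec _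
    have hzero := mulVec_eq_zero_of_reQuad_eq_zero hW (by
      rw [reQuad_sub, reQuad_W_of_mulVec_eq_zero M hY hv,
        reQuad_W_of_mulVec_eq_zero M isHermitian_zero hv0, sub_self])
    rw [sub_mulVec, W_mulVec_of_mulVec_eq_zero M hv, W_mulVec_of_mulVec_eq_zero M hv0,
      mat_mulVec_inl] at hzero
    have hinl (i : Fin n) := congrFun hzero (Sum.inl i)
    simp only [Pi.sub_apply, Sum.elim_inl, zero_mulVec, sub_zero, sub_sub_cancel_left,
      Pi.zero_apply, neg_eq_zero] at hinl
    exact funext hinl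
  have htop := hM.eq_top (K := LinearMap.ker Y.mulVecLin)
    (fun q hq => by simpa using hker (Sum.elim q 0) hq)
    fun u => by simpa using hker (Sum.elim 0 u) (mulVec_zero Y)
  exact toLin'.map_eq_zero_iff.1 (LinearMap.ker_eq_top.1 htop)

lemma continuous_W (M : StateSpace n m) : Continuous M.W := by
  unfold W
  fun_prop

/- A direction of recession `Y` satisfies `M.W Y - M.W 0 ≥ 0`, so it vanishes. -/
open scoped Matrix.Norms.Elementwise in
theorem Minimal.isCompact_setOf_posSemidef_W (hM : M.Minimal) :
    IsCompact {X : Matrix (Fin n) (Fin n) ℂ | X.PosSemidef ∧ (M.W X).PosSemidef} := by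
  set K := {X : Matrix (Fin n) (Fin n) ℂ | X.PosSemidef ∧ (M.W X).PosSemidef}
  have : ProperSpace (Matrix (Fin n) (Fin n) ℂ) := FiniteDimensional.proper ℝ _
  have hclosed : IsClosed K :=
    isClosed_setOf_posSemidef.inter (isClosed_setOf_posSemidef.preimage M.continuous_W)
  have hconvex : Convex ℝ K := by
    rintro X ⟨hX, hWX⟩ Y ⟨hY, hWY⟩ a b ha hb hab
    refine ⟨(hX.smul ha).add (hY.smul hb), ?_⟩
    rw [W_convexCombination M X Y hab]
    exact (hWX.smul ha).add (hWY.smul hb)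
  refine Metric.isCompact_of_isClosed_isBounded hclosed ?_
  obtain hempty | ⟨X, hX⟩ := K.eq_empty_or_nonempty
  · exact hempty ▸ Bornology.isBounded_empty
  refine isBounded_iff_asymptoticCone_subset_singleton.2 fun Y hY => ?_
  have hray (c : ℝ) (hc : 0 ≤ c) : c • Y + X ∈ K :=
    hconvex.smul_vadd_mem_of_isClosed_of_mem_asymptoticCone hclosed hc hY hX
  refine eq_zero_of_posSemidef_W_sub hM.1
    (posSemidef_of_forall_smul_add_posSemidef fun c hc => (hray c hc).1).1
    (posSemidef_of_forall_smul_add_posSemidef (P := M.W X) fun c hc => ?_)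
  rw [← W_smul_add]
  exact (hray c hc).2

end StateSpace

section Resolvent

variable {ι : Type*} [Fintype ι] [DecidableEq ι] {A : Matrix ι ι ℂ}

open scoped Matrix.Norms.L2Operator in
lemma tendsto_inv_smul_one_sub_atTop (A : Matrix ι ι ℂ) :
    Tendsto (fun t : ℝ => ((t : ℂ) • (1 : Matrix ι ι ℂ) - A)⁻¹) atTop (𝓝 0) := by
  have : CompleteSpace (Matrix ι ι ℂ) := FiniteDimensional.complete ℂ _
  refine ((spectrum.resolvent_tendsto_cobounded (𝕜 := ℂ) A).comp
    (RCLike.tendsto_ofReal_atTop_cobounded ℂ)).congr fun t => ?_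
  rw [Function.comp_apply, resolvent, nonsing_inv_eq_ringInverse, Algebra.algebraMap_eq_smul_one]
  rfl

lemma eventually_ofReal_notMem_spectrum (A : Matrix ι ι ℂ) :
    ∀ᶠ t : ℝ in atTop, (t : ℂ) ∉ spectrum ℂ A :=
  atTop_le_cofinite
    (((finite_spectrum A).preimage Complex.ofReal_injective.injOn).compl_mem_cofinite)

lemma smul_inv_smul_one_sub {s : ℂ} (hs : s ∉ spectrum ℂ A) :
    s • (s • (1 : Matrix ι ι ℂ) - A)⁻¹ = 1 + A * (s • (1 : Matrix ι ι ℂ) - A)⁻¹ := by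
  have h := mul_nonsing_inv _ (isUnit_det_smul_one_sub hs)
  rw [Matrix.sub_mul, Matrix.smul_mul, Matrix.one_mul] at h
  exact sub_eq_iff_eq_add.1 h

end Resolvent

namespace StateSpace

variable {n m k : ℕ} {M : StateSpace n m} {M' : StateSpace k m}

lemma tendsto_transfer_atTop (M : StateSpace n m) :
    Tendsto (fun t : ℝ => M.transfer t) atTop (𝓝 M.D) := by
  have hcont : Continuous fun R : Matrix (Fin n) (Fin n) ℂ => M.D + M.C * R * M.B := by fun_prop
  have hlim := (hcont.tendsto 0).comp (tendsto_inv_smul_one_sub_atTop M.A)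
  rwa [Matrix.mul_zero, Matrix.zero_mul, add_zero] at hlim

lemma SameTransfer.symm (h : M.SameTransfer M') : M'.SameTransfer M :=
  fun s hs' hs => (h s hs hs').symm

lemma SameTransfer.D_eq (h : M.SameTransfer M') : M.D = M'.D := by
  refine tendsto_nhds_unique (M.tendsto_transfer_atTop.congr' ?_) M'.tendsto_transfer_atTop
  filter_upwards [eventually_ofReal_notMem_spectrum M.A, eventually_ofReal_notMem_spectrum M'.A]
    with t hs hs'
  exact h t hs hs'

/-- The realization `{A, B, CA, CB}` of `s (T(s) - T(∞))`: its Markov parameters are those of `M`,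
shifted by one place. -/
def markovShift (M : StateSpace n m) : StateSpace n m :=
  ⟨M.A, M.B, M.C * M.A, M.C * M.B⟩

lemma transfer_markovShift {s : ℂ} (hs : s ∉ spectrum ℂ M.A) :
    M.markovShift.transfer s = s • (M.transfer s - M.D) := by
  simp only [transfer, markovShift]
  rw [add_sub_cancel_left, ← Matrix.smul_mul, ← Matrix.mul_smul, smul_inv_smul_one_sub hs,
    Matrix.mul_add, Matrix.mul_one, Matrix.add_mul, Matrix.mul_assoc M.C M.A]

lemma SameTransfer.markovShift (h : M.SameTransfer M') :
    M.markovShift.SameTransfer M'.markovShift := fun s hs hs' => by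
  rw [transfer_markovShift (M := M) hs, transfer_markovShift (M := M') hs', h s hs hs', h.D_eq]

theorem SameTransfer.mul_pow_mul_eq (h : M.SameTransfer M') (i : ℕ) :
    M.C * M.A ^ i * M.B = M'.C * M'.A ^ i * M'.B := by
  induction i generalizing M M' with
  | zero => simpa only [pow_zero, Matrix.mul_one, StateSpace.markovShift] using h.markovShift.D_eq
  | succ i ih =>
    simpa only [pow_succ', Matrix.mul_assoc, StateSpace.markovShift] using ih h.markovShift

/-- The reachable space of `M` and `M'` driven by a common input: the span of the pairs
`(Aⁱ B u, A'ⁱ B' u)`. For two realizations of one transfer function it relates the states that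
give the same output. -/
def jointReachable (M : StateSpace n m) (M' : StateSpace k m) :
    Submodule ℂ ((Fin n → ℂ) × (Fin k → ℂ)) :=
  Submodule.span ℂ
    {p | ∃ (i : ℕ) (u : Fin m → ℂ), p = (M.A ^ i *ᵥ (M.B *ᵥ u), M'.A ^ i *ᵥ (M'.B *ᵥ u))}

lemma mulVec_mem_jointReachable {p : (Fin n → ℂ) × (Fin k → ℂ)}
    (hp : p ∈ M.jointReachable M') : (M.A *ᵥ p.1, M'.A *ᵥ p.2) ∈ M.jointReachable M' := by
  suffices M.jointReachable M' ≤
      (M.jointReachable M').comap (M.A.mulVecLin.prodMap M'.A.mulVecLin) from this hp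
  refine Submodule.span_le.2 ?_
  rintro _ ⟨i, u, rfl⟩
  refine Submodule.subset_span ⟨i + 1, u, ?_⟩
  simp only [pow_succ', ← mulVec_mulVec, LinearMap.prodMap_apply, mulVecLin_apply]

lemma input_mem_jointReachable (M : StateSpace n m) (M' : StateSpace k m) (u : Fin m → ℂ) :
    (M.B *ᵥ u, M'.B *ᵥ u) ∈ M.jointReachable M' :=
  Submodule.subset_span ⟨0, u, by simp only [pow_zero, one_mulVec]⟩

lemma SameTransfer.output_eq (h : M.SameTransfer M') {p : (Fin n → ℂ) × (Fin k → ℂ)}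
    (hp : p ∈ M.jointReachable M') : M.C *ᵥ p.1 = M'.C *ᵥ p.2 := by
  suffices M.jointReachable M' ≤ LinearMap.eqLocus (M.C.mulVecLin ∘ₗ LinearMap.fst ℂ _ _)
      (M'.C.mulVecLin ∘ₗ LinearMap.snd ℂ _ _) from this hp
  refine Submodule.span_le.2 ?_
  rintro _ ⟨i, u, rfl⟩
  change M.C *ᵥ (M.A ^ i *ᵥ (M.B *ᵥ u)) = M'.C *ᵥ (M'.A ^ i *ᵥ (M'.B *ᵥ u))
  simp only [mulVec_mulVec, ← Matrix.mul_assoc, h.mul_pow_mul_eq i]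

lemma swap_mem_jointReachable {p : (Fin n → ℂ) × (Fin k → ℂ)} (hp : p ∈ M.jointReachable M') :
    p.swap ∈ M'.jointReachable M := by
  suffices M.jointReachable M' ≤ (M'.jointReachable M).comap
      (LinearEquiv.prodComm ℂ (Fin n → ℂ) (Fin k → ℂ)).toLinearMap from this hp
  refine Submodule.span_le.2 ?_
  rintro _ ⟨i, u, rfl⟩
  exact Submodule.subset_span ⟨i, u, rfl⟩

lemma exists_mem_jointReachable (hM : Controllable M.A M.B) (M' : StateSpace k m)
    (x : Fin n → ℂ) : ∃ x', (x, x') ∈ M.jointReachable M' := by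
  have htop : (M.jointReachable M').map (LinearMap.fst ℂ _ _) = ⊤ := by
    refine hM.eq_top ?_ fun u => ⟨_, input_mem_jointReachable M M' u, rfl⟩
    rintro _ ⟨p, hp, rfl⟩
    exact ⟨_, mulVec_mem_jointReachable hp, rfl⟩
  obtain ⟨p, hp, hpx⟩ := htop.ge (Submodule.mem_top (x := x))
  exact ⟨p.2, hpx ▸ hp⟩

lemma SameTransfer.eq_zero_of_mem_jointReachable (h : M.SameTransfer M')
    (hM : Controllable M.Aᴴ M.Cᴴ) {x : Fin n → ℂ} (hx : (x, 0) ∈ M.jointReachable M') : x = 0 := by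
  have hbot : (M.jointReachable M').comap (LinearMap.inl ℂ _ _) = ⊥ := by
    refine hM.eq_bot (fun y hy => ?_) fun y hy => ?_
    · simpa using mulVec_mem_jointReachable hy
    · simpa using h.output_eq hy
  exact (Submodule.mem_bot ℂ).1 (hbot ▸ hx)

lemma SameTransfer.bijective_fst_jointReachable (h : M.SameTransfer M')
    (hM : Controllable M.A M.B) (hM' : Controllable M'.Aᴴ M'.Cᴴ) :
    Function.Bijective (Prod.fst ∘ (M.jointReachable M').subtype) := by
  refine ⟨?_, fun x => ?_⟩
  · rintro ⟨⟨x, y⟩, hy⟩ ⟨⟨x', y'⟩, hy'⟩ hxx'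
    obtain rfl : x = x' := hxx'
    have hsub := swap_mem_jointReachable (Submodule.sub_mem _ hy hy')
    rw [Prod.mk_sub_mk, sub_self] at hsub
    rw [Subtype.mk.injEq, sub_eq_zero.1 (h.symm.eq_zero_of_mem_jointReachable hM' hsub)]
  · obtain ⟨x', hx'⟩ := exists_mem_jointReachable hM M' x
    exact ⟨⟨_, hx'⟩, rfl⟩

lemma SameTransfer.bijective_snd_jointReachable (h : M.SameTransfer M')
    (hM' : Controllable M'.A M'.B) (hM : Controllable M.Aᴴ M.Cᴴ) :
    Function.Bijective (Prod.snd ∘ (M.jointReachable M').subtype) := by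
  have hswap : Function.Bijective fun p : M.jointReachable M' =>
      (⟨p.1.swap, swap_mem_jointReachable p.2⟩ : M'.jointReachable M) :=
    ⟨fun p q hpq => Subtype.ext (Prod.swap_injective (congrArg Subtype.val hpq)),
      fun q => ⟨⟨q.1.swap, swap_mem_jointReachable q.2⟩, rfl⟩⟩
  exact (h.symm.bijective_fst_jointReachable hM' hM).comp hswap

/- If `z` is not an eigenvalue of `M'.A`, then `(A - z, A' - z)` is injective, hence surjective, on
the joint reachable space, which projects onto the state space of `M`. -/
theorem SameTransfer.spectrum_subset (h : M.SameTransfer M') (hM : M.Minimal) :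
    spectrum ℂ M.A ⊆ spectrum ℂ M'.A := by
  intro z hz
  by_contra hz'
  let f : (Fin n → ℂ) × (Fin k → ℂ) →ₗ[ℂ] (Fin n → ℂ) × (Fin k → ℂ) :=
    M.A.mulVecLin.prodMap M'.A.mulVecLin - z • LinearMap.id
  have hf : ∀ p ∈ M.jointReachable M', f p ∈ M.jointReachable M' := fun p hp =>
    Submodule.sub_mem _ (mulVec_mem_jointReachable hp) (Submodule.smul_mem _ z hp)
  have hinj : Function.Injective (f.restrict hf) := by
    refine (injective_iff_map_eq_zero _).2 ?_
    rintro ⟨⟨x, x'⟩, hp⟩ hfp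
    have hx' : x' = 0 := eq_zero_of_mulVec_eq_smul hz'
      (sub_eq_zero.1 (congrArg (fun q => q.1.2) hfp))
    subst hx'
    rw [Submodule.mk_eq_zero, h.eq_zero_of_mem_jointReachable hM.2 hp, Prod.mk_zero_zero]
  let g : Module.End ℂ (Fin n → ℂ) := M.A.mulVecLin - z • LinearMap.id
  have hsurj : Function.Surjective g := fun x => by
    obtain ⟨x', hp⟩ := exists_mem_jointReachable hM.1 M' x
    obtain ⟨q, hq⟩ := LinearMap.injective_iff_surjective.1 hinj ⟨_, hp⟩
    exact ⟨q.1.1, congrArg (fun q => q.1.1) hq⟩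
  obtain ⟨q, hq0, hq⟩ := mem_spectrum_iff_exists_mulVec.1 hz
  refine hq0 (LinearMap.injective_iff_surjective.2 hsurj (.trans ?_ (map_zero _).symm))
  exact sub_eq_zero.2 hq

lemma mem_spectrum_shift (M : StateSpace n m) (ξ : ℝ) (z : ℂ) :
    z ∈ spectrum ℂ (M.shift ξ).A ↔ z - ((ξ / 2 : ℝ) : ℂ) ∈ spectrum ℂ M.A := by
  rw [mem_spectrum_iff_exists_mulVec, mem_spectrum_iff_exists_mulVec]
  refine exists_congr fun q => and_congr_right fun _ => ?_
  rw [shift, add_mulVec, smul_mulVec, one_mulVec, sub_smul, eq_sub_iff_add_eq]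

lemma transfer_shift (M : StateSpace n m) (ξ : ℝ) (s : ℂ) :
    (M.shift ξ).transfer s = M.transfer (s - ((ξ / 2 : ℝ) : ℂ)) -
      ((ξ / 2 : ℝ) : ℂ) • (1 : Matrix (Fin m) (Fin m) ℂ) := by
  simp only [transfer, shift]
  rw [sub_smul, sub_sub, add_comm (((ξ / 2 : ℝ) : ℂ) • (1 : Matrix (Fin n) (Fin n) ℂ))]
  abel

lemma SameTransfer.shift (h : M.SameTransfer M') (ξ : ℝ) :
    (M.shift ξ).SameTransfer (M'.shift ξ) := fun s hs hs' => by
  rw [mem_spectrum_shift] at hs hs'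
  rw [transfer_shift, transfer_shift, h _ hs hs']

theorem SameTransfer.strictlyPassive_shift (h : M.SameTransfer M') (hM : M.Minimal) {ξ : ℝ}
    (hξ : (M'.shift ξ).StrictlyPassive) : (M.shift ξ).StrictlyPassive := by
  have hsub (z : ℂ) (hz : z ∈ spectrum ℂ (M.shift ξ).A) : z ∈ spectrum ℂ (M'.shift ξ).A :=
    (mem_spectrum_shift _ _ _).2 (h.spectrum_subset hM ((mem_spectrum_shift _ _ _).1 hz))
  refine ⟨fun z hz => hξ.1 z (hsub z hz), fun ω => ?_, (h.shift ξ).D_eq ▸ hξ.2.2⟩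
  have hω := hξ.I_mul_notMem_spectrum ω
  rw [h.shift ξ _ (fun hmem => hω (hsub _ hmem)) hω]
  exact hξ.2.1 ω

theorem SameTransfer.exists_eq_transform (h : M.SameTransfer M') (hM : M.Minimal)
    (hM' : M'.Minimal) : ∃ (V : Matrix (Fin k) (Fin n) ℂ) (V' : Matrix (Fin n) (Fin k) ℂ),
      V * V' = 1 ∧ V' * V = 1 ∧ M' = M.transform V V' := by
  obtain ⟨e, he⟩ := Submodule.exists_equiv_eq_graph (h.bijective_fst_jointReachable hM.1 hM'.2)
    (h.bijective_snd_jointReachable hM'.1 hM.2)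
  have hmem {x x'} : (x, x') ∈ M.jointReachable M' ↔ x' = e x := by
    rw [he, LinearMap.mem_graph_iff, LinearEquiv.coe_coe]
  set V := e.toLinearMap.toMatrix'
  have hV (x : Fin n → ℂ) : V *ᵥ x = e x := LinearMap.toMatrix'_mulVec _ x
  have hright : V * e.symm.toLinearMap.toMatrix' = 1 := by
    rw [← LinearMap.toMatrix'_comp, e.comp_symm, LinearMap.toMatrix'_id]
  have hleft : e.symm.toLinearMap.toMatrix' * V = 1 := by
    rw [← LinearMap.toMatrix'_comp, e.symm_comp, LinearMap.toMatrix'_id]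
  have hgraph (x : Fin n → ℂ) : (x, V *ᵥ x) ∈ M.jointReachable M' := hmem.2 (hV x)
  have hA : M'.A * V = V * M.A := ext_of_mulVec_single fun i => by
    rw [← mulVec_mulVec, ← mulVec_mulVec, hV (M.A *ᵥ _)]
    exact hmem.1 (mulVec_mem_jointReachable (hgraph _))
  have hB : M'.B = V * M.B := ext_of_mulVec_single fun i => by
    rw [← mulVec_mulVec, hV]
    exact hmem.1 (input_mem_jointReachable M M' _)
  have hC : M.C = M'.C * V := ext_of_mulVec_single fun i => by
    rw [← mulVec_mulVec]
    exact h.output_eq (hgraph _)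
  refine ⟨V, _, hright, hleft, ?_⟩
  rw [transform, ← hA, ← hB, hC, h.D_eq, Matrix.mul_assoc, Matrix.mul_assoc, hright,
    Matrix.mul_one, Matrix.mul_one]

end StateSpace

/- Projecting `C ∩ (T × K)` to `T` along the compact factor gives a closed set. -/
lemma exists_mem_of_mem_closure {T E : Type*} [TopologicalSpace T] [TopologicalSpace E]
    {K : Set E} (hK : IsCompact K) {C : Set (T × E)} (hC : IsClosed C) {S : Set T} {b : T}
    (hb : b ∈ closure S) (h : ∀ t ∈ S, ∃ x ∈ K, (t, x) ∈ C) : ∃ x ∈ K, (b, x) ∈ C := by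
  have := isCompact_iff_compactSpace.1 hK
  have hclosed : IsClosed (Prod.fst '' {p : T × K | (p.1, (p.2 : E)) ∈ C}) :=
    isClosedMap_fst_of_compactSpace _ (hC.preimage (by fun_prop))
  have hsub : S ⊆ Prod.fst '' {p : T × K | (p.1, (p.2 : E)) ∈ C} := fun t ht =>
    let ⟨x, hx, htx⟩ := h t ht
    ⟨(t, ⟨x, hx⟩), htx, rfl⟩
  obtain ⟨⟨t, x⟩, hx, rfl⟩ := closure_minimal hsub hclosed hb
  exact ⟨x, x.2, hx⟩

namespace StateSpace

variable {n m k : ℕ} {M : StateSpace n m} {X : Matrix (Fin n) (Fin n) ℂ}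

section Shift

/-- The matrix `diag (X, I)`, the rate at which `W(X, M_ξ)` decreases in `ξ`. -/
def weight (m : ℕ) (X : Matrix (Fin n) (Fin n) ℂ) : Matrix (Fin n ⊕ Fin m) (Fin n ⊕ Fin m) ℂ :=
  fromBlocks X 0 0 1

lemma posSemidef_weight (hX : X.PosSemidef) : (weight m X).PosSemidef := by
  let := invertibleOne (α := Matrix (Fin m) (Fin m) ℂ)
  simpa [weight] using
    (PosDef.fromBlocks₂₂ X (0 : Matrix (Fin n) (Fin m) ℂ) PosDef.one).2 (by simpa using hX)

lemma posDef_weight (hX : X.PosDef) : (weight m X).PosDef :=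
  (posSemidef_weight hX.posSemidef).posDef_iff_isUnit.2
    (isUnit_fromBlocks_zero₂₁.2 ⟨hX.isUnit, isUnit_one⟩)

lemma norm_signedWeight_mulVec (X : Matrix (Fin n) (Fin n) ℂ) (v : Fin n ⊕ Fin m → ℂ) :
    ‖toLp 2 (signedWeight m X *ᵥ v)‖ = ‖toLp 2 (weight m X *ᵥ v)‖ := by
  simp [signedWeight, weight, fromBlocks_mulVec, EuclideanSpace.norm_eq, neg_mulVec]

lemma norm_signedWeight_one_mulVec (v : Fin n ⊕ Fin m → ℂ) :
    ‖toLp 2 (signedWeight m (1 : Matrix (Fin n) (Fin n) ℂ) *ᵥ v)‖ = ‖toLp 2 v‖ := by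
  rw [norm_signedWeight_mulVec, weight, fromBlocks_one, one_mulVec]

lemma reQuad_weight_le (X : Matrix (Fin n) (Fin n) ℂ) (v : Fin n ⊕ Fin m → ℂ) :
    reQuad (weight m X) v ≤ ‖toLp 2 (signedWeight m X *ᵥ v)‖ * ‖toLp 2 v‖ := by
  rw [norm_signedWeight_mulVec, mul_comm]
  exact (Complex.re_le_norm _).trans (norm_star_dotProduct_le _ _)

lemma W_shift (M : StateSpace n m) (ξ : ℝ) (X : Matrix (Fin n) (Fin n) ℂ) :
    (M.shift ξ).W X = M.W X - ξ • weight m X := by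
  have hhalf : (ξ : ℂ) = ((ξ / 2 : ℝ) : ℂ) + ((ξ / 2 : ℝ) : ℂ) := by push_cast; ring
  rw [eq_sub_iff_add_eq, ← Complex.coe_smul ξ (weight m X), W, W, weight, fromBlocks_smul,
    fromBlocks_add]
  simp only [shift, conjTranspose_add, conjTranspose_sub, conjTranspose_smul, conjTranspose_one,
    Complex.star_def, Complex.conj_ofReal, Matrix.add_mul, Matrix.mul_add, Matrix.smul_mul,
    Matrix.mul_smul, Matrix.one_mul, Matrix.mul_one, smul_zero, add_zero, hhalf]
  congr 1 <;> module

lemma shift_zero (M : StateSpace n m) : M.shift 0 = M := by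
  ext1 <;> simp [shift]

lemma posSemidef_W_shift_of_le (hX : X.PosSemidef) {ξ ξ' : ℝ}
    (h : ((M.shift ξ).W X).PosSemidef) (hle : ξ' ≤ ξ) : ((M.shift ξ').W X).PosSemidef := by
  convert h.add ((posSemidef_weight hX).smul (sub_nonneg.2 hle)) using 1
  rw [W_shift, W_shift]
  module

lemma posDef_W_of_posSemidef_W_shift (hX : X.PosDef) {ξ : ℝ}
    (h : ((M.shift ξ).W X).PosSemidef) (hξ : 0 < ξ) : (M.W X).PosDef := by
  convert PosDef.posSemidef_add h ((posDef_weight hX).smul hξ) using 1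
  rw [W_shift, sub_add_cancel]

end Shift

section MaxShift

lemma bddAbove_setOf_strictlyPassive_shift (hm : 0 < m) (M : StateSpace n m) :
    BddAbove {ξ : ℝ | (M.shift ξ).StrictlyPassive} := by
  let i : Fin m := ⟨0, hm⟩
  refine ⟨((M.Dᴴ + M.D) i i).re, fun ξ hξ => ?_⟩
  have hdiag := (Complex.pos_iff.1 (hξ.2.2.diag_pos (i := i))).1
  have hshift : (((M.shift ξ).Dᴴ + (M.shift ξ).D) i i).re = ((M.Dᴴ + M.D) i i).re - ξ := by
    simp [shift]
    ring
  linarith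

lemma StrictlyPassive.exists_pos_shift (h : M.StrictlyPassive) :
    ∃ ξ : ℝ, 0 < ξ ∧ (M.shift ξ).StrictlyPassive := by
  obtain ⟨X, hX, hW⟩ := h.exists_posDef_W
  have hcont : Continuous fun ξ : ℝ => M.W X - ξ • weight m X := by fun_prop
  have hopen := isOpen_setOf_reQuad_pos.preimage hcont
  have hzero : ∀ᶠ ξ : ℝ in 𝓝 0, ∀ v, v ≠ 0 → 0 < reQuad (M.W X - ξ • weight m X) v :=
    hopen.eventually_mem fun v hv => by simpa using reQuad_pos hW hv
  obtain ⟨ξ, hquad, hξ⟩ :=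
    ((hzero.filter_mono nhdsWithin_le_nhds).and (self_mem_nhdsWithin (s := Set.Ioi 0))).exists
  refine ⟨ξ, hξ, strictlyPassive_of_posDef_W hX ?_⟩
  rwa [posDef_iff_reQuad (isHermitian_W _ hX.1), W_shift]

lemma isLUB_maxShift (hm : 0 < m) (hP : M.StrictlyPassive) :
    IsLUB {ξ : ℝ | (M.shift ξ).StrictlyPassive} M.maxShift :=
  isLUB_csSup (hP.exists_pos_shift.imp fun _ => And.right)
    (bddAbove_setOf_strictlyPassive_shift hm M)

lemma maxShift_pos (hm : 0 < m) (hP : M.StrictlyPassive) : 0 < M.maxShift :=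
  let ⟨_, hξ, hs⟩ := hP.exists_pos_shift
  hξ.trans_le ((isLUB_maxShift hm hP).1 hs)

theorem SameTransfer.passivityMargin_le {M' : StateSpace k m} (h : M.SameTransfer M') (hm : 0 < m)
    (hM : M.Minimal) (hP : M.StrictlyPassive) (ν : NormKind) :
    M'.passivityMargin ν ≤ ENNReal.ofReal (M.maxShift / 2) := by
  have hlim : Tendsto (fun ξ : ℝ => ENNReal.ofReal (ξ / 2)) (𝓝[>] M.maxShift)
      (𝓝 (ENNReal.ofReal (M.maxShift / 2))) :=
    ((ENNReal.continuous_ofReal.comp (by fun_prop)).tendsto _).mono_left nhdsWithin_le_nhds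
  refine ge_of_tendsto hlim (eventually_mem_nhdsWithin.mono fun ξ (hξ : M.maxShift < ξ) => ?_)
  refine passivityMargin_le_of_not_strictlyPassive_shift ν ((maxShift_pos hm hP).trans hξ).le ?_
  exact fun hs => hξ.not_ge ((isLUB_maxShift hm hP).1 (h.strictlyPassive_shift hM hs))

theorem Minimal.exists_posSemidef_W_shift_maxShift (hM : M.Minimal) (hm : 0 < m)
    (hP : M.StrictlyPassive) :
    ∃ X : Matrix (Fin n) (Fin n) ℂ, X.PosDef ∧ ((M.shift M.maxShift).W X).PosSemidef := by
  have hcont : Continuous fun p : ℝ × Matrix (Fin n) (Fin n) ℂ => M.W p.2 - p.1 • weight m p.2 := by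
    unfold W weight
    fun_prop
  have hnear (ξ : ℝ) (hξ : (M.shift ξ).StrictlyPassive) : ∃ X, (X.PosSemidef ∧ (M.W X).PosSemidef) ∧
      (M.W X - ξ • weight m X).PosSemidef := by
    have hmax : (M.shift (max ξ 0)).StrictlyPassive :=
      max_rec' (fun ξ => (M.shift ξ).StrictlyPassive) hξ (by rwa [shift_zero])
    obtain ⟨X, hX, hW⟩ := hmax.exists_posDef_W
    have hle {ξ'} (hξ' : ξ' ≤ max ξ 0) : ((M.shift ξ').W X).PosSemidef :=
      posSemidef_W_shift_of_le hX.posSemidef hW.posSemidef hξ'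
    exact ⟨X, ⟨hX.posSemidef, shift_zero M ▸ hle (le_max_right _ _)⟩,
      W_shift M ξ X ▸ hle (le_max_left _ _)⟩
  obtain ⟨X, hX, hXs⟩ := exists_mem_of_mem_closure hM.isCompact_setOf_posSemidef_W
    (isClosed_setOf_posSemidef.preimage hcont)
    ((isLUB_maxShift hm hP).mem_closure (hP.exists_pos_shift.imp fun _ => And.right)) hnear
  exact ⟨X, posDef_of_posSemidef_W hM.2 hX.1 hX.2, W_shift M _ X ▸ hXs⟩

end MaxShift

section Attainment

lemma xPassivityRadius_le_passivityRadius (ν : NormKind) (hX : X.PosDef) (hW : (M.W X).PosDef) :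
    M.xPassivityRadius ν X ≤ M.passivityRadius ν :=
  le_iSup₂ (f := fun X (_ : X.PosDef ∧ (M.W X).PosDef) => M.xPassivityRadius ν X) X ⟨hX, hW⟩

theorem Minimal.exists_xPassivityRadius_eq (hM : M.Minimal) (ν : NormKind) {r : ℝ} (hr : 0 < r)
    (hρ : M.passivityRadius ν = ENNReal.ofReal r) :
    ∃ X : Matrix (Fin n) (Fin n) ℂ, X.PosDef ∧ (M.W X).PosDef ∧
      M.xPassivityRadius ν X = ENNReal.ofReal r := by
  have hclosed : IsClosed {p : ℝ × Matrix (Fin n) (Fin n) ℂ | ∀ v : Fin n ⊕ Fin m → ℂ,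
      2 * p.1 * (‖toLp 2 (signedWeight m p.2 *ᵥ v)‖ * ‖toLp 2 v‖) ≤ reQuad (M.W p.2) v} := by
    simp only [Set.ofPred_forall]
    refine isClosed_iInter fun v => isClosed_le ?_ ?_
    · unfold signedWeight
      fun_prop
    · exact continuous_reQuad.comp ((M.continuous_W.comp continuous_snd).prodMk continuous_const)
  have hnear (t : ℝ) (ht : t ∈ Set.Iio r) : ∃ X, (X.PosSemidef ∧ (M.W X).PosSemidef) ∧
      ∀ v, 2 * t * (‖toLp 2 (signedWeight m X *ᵥ v)‖ * ‖toLp 2 v‖) ≤ reQuad (M.W X) v := by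
    have hlt : ENNReal.ofReal t < M.passivityRadius ν :=
      hρ ▸ (ENNReal.ofReal_lt_ofReal_iff hr).2 ht
    simp only [passivityRadius, lt_iSup_iff] at hlt
    obtain ⟨X, ⟨hX, hW⟩, hlt⟩ := hlt
    exact ⟨X, ⟨hX.posSemidef, hW.posSemidef⟩,
      le_reQuad_of_ofReal_le_xPassivityRadius ν hX hW hlt.le⟩
  obtain ⟨X, ⟨hX, hW⟩, hquad : ∀ v, 2 * r * _ ≤ _⟩ := exists_mem_of_mem_closure
    hM.isCompact_setOf_posSemidef_W hclosed (closure_Iio r ▸ Set.self_mem_Iic) hnear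
  have hXpos := posDef_of_posSemidef_W hM.2 hX hW
  have hWpos : (M.W X).PosDef := (posDef_iff_reQuad hW.1).2 fun v hv =>
    (mul_pos (by positivity) (mul_pos (norm_toLp_pos (signedWeight_mulVec_ne_zero hXpos hv))
      (norm_toLp_pos hv))).trans_le (hquad v)
  exact ⟨X, hXpos, hWpos, (hρ ▸ xPassivityRadius_le_passivityRadius ν hXpos hWpos).antisymm
    (ofReal_le_xPassivityRadius ν hXpos hquad)⟩

lemma posSemidef_W_shift_of_le_xPassivityRadius (ν : NormKind) (hX : X.PosDef)
    (hW : (M.W X).PosDef) {ξ : ℝ} (hξ : 0 ≤ ξ)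
    (h : ENNReal.ofReal (ξ / 2) ≤ M.xPassivityRadius ν X) : ((M.shift ξ).W X).PosSemidef := by
  refine (posSemidef_iff_reQuad (isHermitian_W _ hX.1)).2 fun v => ?_
  have hradius := le_reQuad_of_ofReal_le_xPassivityRadius ν hX hW h v
  rw [mul_div_cancel₀ ξ two_ne_zero] at hradius
  rw [W_shift, reQuad_sub, reQuad_smul, sub_nonneg]
  exact (mul_le_mul_of_nonneg_left (reQuad_weight_le X v) hξ).trans hradius

/- For `X = I` the matrix `diag (-X, I)` is unitary, so the bound `reQuad_weight_le` is sharp. -/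
lemma ofReal_le_xPassivityRadius_one (ν : NormKind) {ξ : ℝ} (h : ((M.shift ξ).W 1).PosSemidef) :
    ENNReal.ofReal (ξ / 2) ≤ M.xPassivityRadius ν 1 := by
  refine ofReal_le_xPassivityRadius ν PosDef.one fun v => ?_
  have hshift := reQuad_nonneg h v
  rw [W_shift, reQuad_sub, reQuad_smul, weight, fromBlocks_one, reQuad_one] at hshift
  rw [norm_signedWeight_one_mulVec, mul_div_cancel₀ ξ two_ne_zero, ← sq]
  linarith

end Attainment

end StateSpace

lemma mul_mul_cancel_left_of_mul_eq_one {R ι κ l : Type*} [Semiring R] [Fintype ι] [Fintype κ]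
    [DecidableEq κ] {P : Matrix κ ι R} {Q : Matrix ι κ R} (h : P * Q = 1) (N : Matrix κ l R) :
    P * (Q * N) = N := by
  rw [← Matrix.mul_assoc, h, Matrix.one_mul]

lemma mulVec_injective_of_mul_eq_one {R ι κ : Type*} [Semiring R] [Fintype ι] [Fintype κ]
    [DecidableEq κ] {P : Matrix κ ι R} {Q : Matrix ι κ R} (h : P * Q = 1) :
    Function.Injective Q.mulVec :=
  Function.LeftInverse.injective (g := P.mulVec) fun x => by rw [mulVec_mulVec, h, one_mulVec]

open scoped MatrixOrder in
lemma exists_isUnit_eq_conjTranspose_mul_self {ι : Type*} [Fintype ι] [DecidableEq ι]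
    {X : Matrix ι ι ℂ} (hX : X.PosDef) : ∃ T : Matrix ι ι ℂ, IsUnit T ∧ X = Tᴴ * T :=
  CStarAlgebra.isStrictlyPositive_iff_eq_star_mul_self.1 hX.isStrictlyPositive

lemma conjTranspose_mul_mul_conjTranspose_mul_mul {R ι κ : Type*} [Semiring R] [StarRing R]
    [Fintype ι] [Fintype κ] [DecidableEq ι] {V : Matrix κ ι R} {V' : Matrix ι κ R}
    (h : V' * V = 1) (X : Matrix ι ι R) : Vᴴ * (V'ᴴ * X * V') * V = X := by
  have hstar : Vᴴ * V'ᴴ = 1 := by rw [← conjTranspose_mul, h, conjTranspose_one]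
  rw [← Matrix.mul_assoc, ← Matrix.mul_assoc, hstar, Matrix.one_mul, Matrix.mul_assoc, h,
    Matrix.mul_one]

lemma conjTranspose_inv_mul_gram_mul_inv {R ι : Type*} [CommRing R] [StarRing R] [Fintype ι]
    [DecidableEq ι] {T : Matrix ι ι R} (hT : IsUnit T.det) : T⁻¹ᴴ * (Tᴴ * T) * T⁻¹ = 1 := by
  simpa only [Matrix.mul_one] using
    conjTranspose_mul_mul_conjTranspose_mul_mul (mul_nonsing_inv T hT) 1

namespace StateSpace

variable {n m k : ℕ} {M : StateSpace n m} {X : Matrix (Fin n) (Fin n) ℂ}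

section Transform

variable {V : Matrix (Fin k) (Fin n) ℂ} {V' : Matrix (Fin n) (Fin k) ℂ}

lemma W_transform (M : StateSpace n m) (h : V' * V = 1) (X : Matrix (Fin n) (Fin n) ℂ) :
    (M.transform V V').W (V'ᴴ * X * V') =
      (fromBlocks V' 0 0 1 : Matrix (Fin n ⊕ Fin m) (Fin k ⊕ Fin m) ℂ)ᴴ * M.W X *
        (fromBlocks V' 0 0 1 : Matrix (Fin n ⊕ Fin m) (Fin k ⊕ Fin m) ℂ) := by
  have hstar : Vᴴ * V'ᴴ = 1 := by rw [← conjTranspose_mul, h, conjTranspose_one]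
  simp only [W, transform, fromBlocks_conjTranspose, fromBlocks_multiply, conjTranspose_mul,
    conjTranspose_zero, conjTranspose_one, Matrix.zero_mul, Matrix.mul_zero, add_zero, zero_add,
    Matrix.one_mul, Matrix.mul_one, Matrix.mul_assoc, Matrix.mul_sub, Matrix.sub_mul,
    Matrix.mul_neg, Matrix.neg_mul, sub_zero, neg_zero,
    mul_mul_cancel_left_of_mul_eq_one h, mul_mul_cancel_left_of_mul_eq_one hstar]

lemma posSemidef_W_transform (h : V' * V = 1) (hW : (M.W X).PosSemidef) :
    ((M.transform V V').W (V'ᴴ * X * V')).PosSemidef := by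
  rw [W_transform M h]
  exact hW.conjTranspose_mul_mul_same _

lemma posDef_W_transform (h : V' * V = 1) (h' : V * V' = 1) (hW : (M.W X).PosDef) :
    ((M.transform V V').W (V'ᴴ * X * V')).PosDef := by
  rw [W_transform M h]
  refine hW.conjTranspose_mul_mul_same
    (mulVec_injective_of_mul_eq_one (P := fromBlocks V 0 0 1) ?_)
  simp [fromBlocks_multiply, h']

lemma transform_transform (M : StateSpace n m) (h : V' * V = 1) :
    (M.transform V V').transform V' V = M := by
  ext1 <;> simp [transform, Matrix.mul_assoc, mul_mul_cancel_left_of_mul_eq_one h, h]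

lemma transform_shift (M : StateSpace n m) (h' : V * V' = 1) (ξ : ℝ) :
    (M.transform V V').shift ξ = (M.shift ξ).transform V V' := by
  ext1 <;> simp [transform, shift, Matrix.mul_add, Matrix.add_mul, h']

lemma posSemidef_W_shift_transform_iff (h : V' * V = 1) (h' : V * V' = 1) {ξ : ℝ} :
    (((M.transform V V').shift ξ).W (V'ᴴ * X * V')).PosSemidef ↔
      ((M.shift ξ).W X).PosSemidef := by
  rw [transform_shift M h']
  refine ⟨fun hW => ?_, posSemidef_W_transform h⟩
  have hback := posSemidef_W_transform h' hW
  rwa [transform_transform _ h, conjTranspose_mul_mul_conjTranspose_mul_mul h] at hback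

lemma sameTransfer_transform (M : StateSpace n m) (h : V' * V = 1) (h' : V * V' = 1) :
    M.SameTransfer (M.transform V V') := by
  intro s hs _
  set R := s • (1 : Matrix (Fin n) (Fin n) ℂ) - M.A
  have hresolvent : (s • (1 : Matrix (Fin k) (Fin k) ℂ) - V * M.A * V')⁻¹ = V * R⁻¹ * V' := by
    have hconj : s • (1 : Matrix (Fin k) (Fin k) ℂ) - V * M.A * V' = V * R * V' := by
      rw [Matrix.mul_sub, Matrix.sub_mul, Matrix.mul_smul, Matrix.mul_one, Matrix.smul_mul, h']
    refine inv_eq_right_inv ?_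
    rw [hconj, Matrix.mul_assoc, Matrix.mul_assoc, Matrix.mul_assoc V,
      mul_mul_cancel_left_of_mul_eq_one h,
      mul_nonsing_inv_cancel_left _ _ (isUnit_det_smul_one_sub hs), h']
  rw [transfer, transfer, transform, hresolvent]
  simp only [Matrix.mul_assoc, mul_mul_cancel_left_of_mul_eq_one h]
  rfl

end Transform

section Optimal

/- The skew-Hermitian and Hermitian parts of `[A B; -C -D]` are `[J G; -Gᴴ -N]` and
`-[R K; Kᴴ S]`, and the latter is `-W(I, M) / 2`. -/
theorem isPortHamiltonian_one (h : (M.W 1).PosSemidef) : M.IsPortHamiltonian 1 := by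
  have hstar : star (1 / 2 : ℂ) = 1 / 2 := by simp
  refine ⟨PosDef.one, (1 / 2 : ℂ) • (M.A - M.Aᴴ), (1 / 2 : ℂ) • (-M.A - M.Aᴴ),
    (1 / 2 : ℂ) • (M.B + M.Cᴴ), (1 / 2 : ℂ) • (M.Cᴴ - M.B), (1 / 2 : ℂ) • (M.D + M.Dᴴ),
    (1 / 2 : ℂ) • (M.D - M.Dᴴ), ?_, by module, ?_, by module, ?_, ?_⟩
  · rw [Matrix.mul_one]
    module
  · have hC : (1 / 2 : ℂ) • (M.B + M.Cᴴ) + (1 / 2 : ℂ) • (M.Cᴴ - M.B) = M.Cᴴ := by module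
    rw [hC, conjTranspose_conjTranspose, Matrix.mul_one]
  · rw [fromBlocks_conjTranspose, fromBlocks_neg]
    simp only [conjTranspose_smul, conjTranspose_sub, conjTranspose_add, conjTranspose_neg,
      conjTranspose_conjTranspose, hstar]
    congr 1 <;> module
  · convert h.smul (a := (1 / 2 : ℂ)) (by simp) using 1
    rw [W, fromBlocks_smul]
    simp only [conjTranspose_smul, conjTranspose_sub, conjTranspose_conjTranspose, hstar,
      Matrix.mul_one, Matrix.one_mul]
    congr 1 <;> module

section SameTransfer

variable {M' : StateSpace k m}

theorem SameTransfer.passivityRadius_le (h : M.SameTransfer M') (hm : 0 < m) (hM : M.Minimal)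
    (hP : M.StrictlyPassive) (ν : NormKind) :
    M'.passivityRadius ν ≤ ENNReal.ofReal (M.maxShift / 2) :=
  (passivityRadius_le_passivityMargin ν M').trans (h.passivityMargin_le hm hM hP ν)

theorem SameTransfer.radii_eq_of_posSemidef_W_shift_one (h : M.SameTransfer M') (hm : 0 < m)
    (hM : M.Minimal) (hP : M.StrictlyPassive) (ν : NormKind)
    (hW : ((M'.shift M.maxShift).W 1).PosSemidef) :
    M'.xPassivityRadius ν 1 = ENNReal.ofReal (M.maxShift / 2) ∧
      M'.passivityRadius ν = ENNReal.ofReal (M.maxShift / 2) ∧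
      M'.passivityMargin ν = ENNReal.ofReal (M.maxShift / 2) := by
  have hx := ofReal_le_xPassivityRadius_one ν hW
  have hxρ := xPassivityRadius_le_passivityRadius ν PosDef.one
    (posDef_W_of_posSemidef_W_shift PosDef.one hW (maxShift_pos hm hP))
  have hρδ := passivityRadius_le_passivityMargin ν M'
  have hδ := h.passivityMargin_le hm hM hP ν
  exact ⟨(hxρ.trans (hρδ.trans hδ)).antisymm hx, (hρδ.trans hδ).antisymm (hx.trans hxρ),
    hδ.antisymm (hx.trans (hxρ.trans hρδ))⟩

theorem SameTransfer.passivityRadius_eq_iff (h : M.SameTransfer M') (hm : 0 < m)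
    (hM : M.Minimal) (hP : M.StrictlyPassive) (hM' : M'.Minimal) (ν : NormKind) :
    M'.passivityRadius ν = ENNReal.ofReal (M.maxShift / 2) ↔
      ∃ (V : Matrix (Fin k) (Fin n) ℂ) (V' : Matrix (Fin n) (Fin k) ℂ)
        (X : Matrix (Fin n) (Fin n) ℂ), V * V' = 1 ∧ V' * V = 1 ∧ M' = M.transform V V' ∧
        X.PosDef ∧ ((M.shift M.maxShift).W X).PosSemidef ∧
        M'.xPassivityRadius ν (V'ᴴ * X * V') = ENNReal.ofReal (M.maxShift / 2) := by
  have hpos := maxShift_pos hm hP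
  constructor
  · intro hρ
    obtain ⟨V, V', hVV', hV'V, rfl⟩ := h.exists_eq_transform hM hM'
    obtain ⟨Y, hY, hWY, hYρ⟩ := hM'.exists_xPassivityRadius_eq ν (half_pos hpos) hρ
    have hYV : V'ᴴ * (Vᴴ * Y * V) * V' = Y := conjTranspose_mul_mul_conjTranspose_mul_mul hVV' Y
    refine ⟨V, V', Vᴴ * Y * V, hVV', hV'V, rfl,
      hY.conjTranspose_mul_mul_same (mulVec_injective_of_mul_eq_one hV'V), ?_, by rwa [hYV]⟩
    rw [← posSemidef_W_shift_transform_iff hV'V hVV', hYV]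
    exact posSemidef_W_shift_of_le_xPassivityRadius ν hY hWY hpos.le hYρ.ge
  · rintro ⟨V, V', X, hVV', hV'V, rfl, hX, hW, hXρ⟩
    refine (h.passivityRadius_le hm hM hP ν).antisymm ?_
    rw [← hXρ]
    exact xPassivityRadius_le_passivityRadius ν
      (hX.conjTranspose_mul_mul_same (mulVec_injective_of_mul_eq_one hVV'))
      (posDef_W_transform hV'V hVV' (posDef_W_of_posSemidef_W_shift hX hW hpos))

end SameTransfer

section Normalize

variable {T : Matrix (Fin n) (Fin n) ℂ}

lemma posDef_W_one_transform (hT : IsUnit T) (hW : (M.W (Tᴴ * T)).PosDef) :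
    ((M.transform T T⁻¹).W 1).PosDef := by
  have hdet := (isUnit_iff_isUnit_det T).1 hT
  have hback := posDef_W_transform (nonsing_inv_mul T hdet) (mul_nonsing_inv T hdet) hW
  rwa [conjTranspose_inv_mul_gram_mul_inv hdet] at hback

lemma posSemidef_W_one_shift_transform_iff (hT : IsUnit T) {ξ : ℝ} :
    (((M.transform T T⁻¹).shift ξ).W 1).PosSemidef ↔ ((M.shift ξ).W (Tᴴ * T)).PosSemidef := by
  have hdet := (isUnit_iff_isUnit_det T).1 hT
  rw [← posSemidef_W_shift_transform_iff (X := Tᴴ * T) (nonsing_inv_mul T hdet)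
    (mul_nonsing_inv T hdet), conjTranspose_inv_mul_gram_mul_inv hdet]

theorem transform_optimal (hm : 0 < m) (hM : M.Minimal) (hP : M.StrictlyPassive) (ν : NormKind)
    (hT : IsUnit T) (hW : ((M.shift M.maxShift).W (Tᴴ * T)).PosSemidef) :
    (M.W (Tᴴ * T)).PosDef ∧
      M.SameTransfer (M.transform T T⁻¹) ∧
      (M.transform T T⁻¹).IsPortHamiltonian 1 ∧
      (M.transform T T⁻¹).xPassivityRadius ν 1 = ENNReal.ofReal (M.maxShift / 2) ∧
      (M.transform T T⁻¹).passivityRadius ν = ENNReal.ofReal (M.maxShift / 2) ∧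
      (M.transform T T⁻¹).passivityMargin ν = ENNReal.ofReal (M.maxShift / 2) := by
  have hdet := (isUnit_iff_isUnit_det T).1 hT
  have hWpos := posDef_W_of_posSemidef_W_shift
    (PosDef.conjTranspose_mul_self T (mulVec_injective_of_isUnit hT)) hW (maxShift_pos hm hP)
  have hsame := sameTransfer_transform M (nonsing_inv_mul T hdet) (mul_nonsing_inv T hdet)
  exact ⟨hWpos, hsame, isPortHamiltonian_one (posDef_W_one_transform hT hWpos).posSemidef,
    hsame.radii_eq_of_posSemidef_W_shift_one hm hM hP ν
      ((posSemidef_W_one_shift_transform_iff hT).2 hW)⟩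

lemma posSemidef_W_maxShift_of_xPassivityRadius_transform_eq (hm : 0 < m) (hP : M.StrictlyPassive)
    (ν : NormKind) (hT : IsUnit T) (hW : (M.W (Tᴴ * T)).PosDef)
    (hρ : (M.transform T T⁻¹).xPassivityRadius ν 1 = ENNReal.ofReal (M.maxShift / 2)) :
    ((M.shift M.maxShift).W (Tᴴ * T)).PosSemidef :=
  (posSemidef_W_one_shift_transform_iff hT).1 (posSemidef_W_shift_of_le_xPassivityRadius ν
    PosDef.one (posDef_W_one_transform hT hW) (maxShift_pos hm hP).le hρ.ge)

end Normalize

end Optimal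

end StateSpace

theorem mainTheorem1 {n m : ℕ} (hm : 0 < m) (M : StateSpace n m)
    (hmin : M.Minimal) (hpass : M.StrictlyPassive) (ν : NormKind) :
    -- the supremum defining `Ξ` is finite, and positive
    IsLUB {ξ : ℝ | (M.shift ξ).StrictlyPassive} M.maxShift ∧
    0 < M.maxShift ∧
    -- `Ξ / 2` is the largest passivity radius over all realizations, of any state dimension
    IsGreatest {r : ℝ≥0∞ | ∃ (k : ℕ) (M' : StateSpace k m),
        M.SameTransfer M' ∧ M'.passivityRadius ν = r}
      (ENNReal.ofReal (M.maxShift / 2)) ∧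
    -- the same for the smallest perturbation that destroys strict passivity
    IsGreatest {r : ℝ≥0∞ | ∃ (k : ℕ) (M' : StateSpace k m),
        M.SameTransfer M' ∧ M'.passivityMargin ν = r}
      (ENNReal.ofReal (M.maxShift / 2)) ∧
    -- the inequality `W(X, M_Ξ) ≥ 0` has a solution `X > 0`
    (∃ X : Matrix (Fin n) (Fin n) ℂ, X.PosDef ∧ ((M.shift M.maxShift).W X).PosSemidef) ∧
    -- each factored solution `X = Tᴴ T` gives an optimal normalized port-Hamiltonian realization
    (∀ T : Matrix (Fin n) (Fin n) ℂ, IsUnit T →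
      ((M.shift M.maxShift).W (Tᴴ * T)).PosSemidef →
        (M.W (Tᴴ * T)).PosDef ∧
        M.SameTransfer (M.transform T T⁻¹) ∧
        (M.transform T T⁻¹).IsPortHamiltonian 1 ∧
        (M.transform T T⁻¹).xPassivityRadius ν 1 = ENNReal.ofReal (M.maxShift / 2) ∧
        (M.transform T T⁻¹).passivityRadius ν = ENNReal.ofReal (M.maxShift / 2) ∧
        (M.transform T T⁻¹).passivityMargin ν = ENNReal.ofReal (M.maxShift / 2)) ∧
    -- and only these `X` have port-Hamiltonian realizations whose `I`-passivity radius is optimal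
    (∀ T : Matrix (Fin n) (Fin n) ℂ, IsUnit T → (M.W (Tᴴ * T)).PosDef →
      (M.transform T T⁻¹).xPassivityRadius ν 1 = ENNReal.ofReal (M.maxShift / 2) →
        ((M.shift M.maxShift).W (Tᴴ * T)).PosSemidef) ∧
    -- the minimal realizations with optimal passivity radius are those coming from a solution `X`
    (∀ (k : ℕ) (M' : StateSpace k m), M'.Minimal → M.SameTransfer M' →
      (M'.passivityRadius ν = ENNReal.ofReal (M.maxShift / 2) ↔
        ∃ (V : Matrix (Fin k) (Fin n) ℂ) (V' : Matrix (Fin n) (Fin k) ℂ)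
          (X : Matrix (Fin n) (Fin n) ℂ),
          V * V' = 1 ∧ V' * V = 1 ∧ M' = M.transform V V' ∧
          X.PosDef ∧ ((M.shift M.maxShift).W X).PosSemidef ∧
          M'.xPassivityRadius ν (V'ᴴ * X * V') = ENNReal.ofReal (M.maxShift / 2))) := by
  obtain ⟨X, hX, hXW⟩ := hmin.exists_posSemidef_W_shift_maxShift hm hpass
  obtain ⟨T, hT, rfl⟩ := exists_isUnit_eq_conjTranspose_mul_self hX
  obtain ⟨-, hsame, -, -, hρ, hδ⟩ := StateSpace.transform_optimal hm hmin hpass ν hT hXW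
  refine ⟨StateSpace.isLUB_maxShift hm hpass, StateSpace.maxShift_pos hm hpass,
    ⟨⟨n, _, hsame, hρ⟩, ?_⟩, ⟨⟨n, _, hsame, hδ⟩, ?_⟩, ⟨_, hX, hXW⟩,
    fun S hS hSW => StateSpace.transform_optimal hm hmin hpass ν hS hSW,
    fun S hS hSW => StateSpace.posSemidef_W_maxShift_of_xPassivityRadius_transform_eq
      hm hpass ν hS hSW,
    fun k M' hM' h => h.passivityRadius_eq_iff hm hmin hpass hM' ν⟩
  · rintro _ ⟨k, M', h, rfl⟩
    exact h.passivityRadius_le hm hmin hpass ν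
  · rintro _ ⟨k, M', h, rfl⟩
    exact h.passivityMargin_le hm hmin hpass ν
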